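/- Let $H$ be a complex Hilbert space. For a bounded operator $T$ on $H$ and $k\ge 0$ let $\mu_k(T)=\inf\|TQ^\perp\|$, the infimum being over all orthogonal projections $Q$ of rank at most $k$ and $Q^\perp=I-Q$; for compact $T$ these are the singular values of $T$, in decreasing order and repeated according to multiplicity. (i) Let $T$ and $\sigma$ be compact operators on $H$. Then there exist an integer $d_1\ge 0$ and real sequences $(\varepsilon_k)_{k\ge 0}$, $(\varepsilon'_k)_{k\ge 0}$ with $\lim_k\varepsilon_k=\lim_k\varepsilon'_k=0$ such that for all $k\ge 0$ $$(1-\varepsilon'_k)\,\mu_{k+d_1}(T)\le\mu_k\big(T(I+\sigma)\big)\le(1+\varepsilon_k)\,\mu_k(T).$$ (ii) Let $(\mathcal A,H,D)$ be an essentially discrete spectral triple: $\mathcal A\subseteq B(H)$ is a $*$-algebra and $D$ is a (possibly unbounded) self-adjoint operator on $H$ which has a compact inverse on $\ker(D)^\perp$ (the kernel may be infinite dimensional), such that for every $a\in\mathcal A$ the commutator $[D,a]$ is bounded, that is, $a$ maps the domain of $D$ into itself and $[D,a]$ extends from this domain to a bounded operator on $H$. Let $0<\lambda_1(|D|)\le\lambda_2(|D|)\le\cdots$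 be the nonzero eigenvalues of $|D|$, repeated according to multiplicity, with the convention $\lambda_n(|D|)^{-1}=0$ if there are fewer than $n$ of them. Let $P_0$ be the orthogonal projection onto $\ker(D)$ and $$F:=P_0+\frac{D}{\sqrt{I+D^2}}.$$ Let $a\in\mathcal A$ be such that the commutator $[\,|D|,a]$ is bounded as well. Then there is a real sequence $(\varepsilon_k)_{k\ge 0}$ with $\lim_k\varepsilon_k=0$ such that for all $k\ge 0$ $$\mu_{2k}\big(i[F,a]\big)\le\big(5\,\|[D,a]\|+\|[\,|D|,a]\|\big)\,(1+\varepsilon_k)\,\lambda_{k+1}(|D|)^{-1}.$$ -/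

import Mathlib

open scoped ENNReal

noncomputable section

namespace SpectralTriple

/-- The singular values of a bounded operator `T`, repeated according to multiplicity and
enumerated from `k = 0`:
`μ_k(T) = inf { ‖T Q^⊥‖ : Q an orthogonal projection of rank at most k }`. -/
def singularValue {H : Type*} [NormedAddCommGroup H] [InnerProductSpace ℂ H] [CompleteSpace H]
    (k : ℕ) (T : H →L[ℂ] H) : ℝ :=
  sInf {r : ℝ | ∃ E : Submodule ℂ H, Module.rank ℂ E ≤ k ∧
    r = ‖T ∘L Eᗮ.starProjection‖}

section Operators

variable {H : Type*} [NormedAddCommGroup H] [InnerProductSpace ℂ H]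

/-- The eigenspace `ker (T - c)` of an unbounded operator `T`, for a real number `c`.
In particular `eigenspace T 0` is the kernel of `T`. -/
def eigenspace (T : H →ₗ.[ℂ] H) (c : ℝ) : Submodule ℂ H where
  carrier := {x | ∃ h : x ∈ T.domain, T ⟨x, h⟩ = (c : ℂ) • x}
  zero_mem' := ⟨T.domain.zero_mem, by
    rw [smul_zero]; exact T.map_zero⟩
  add_mem' := by
    rintro x y ⟨hx, hx'⟩ ⟨hy, hy'⟩
    refine ⟨T.domain.add_mem hx hy, ?_⟩
    rw [smul_add, ← hx', ← hy', ← T.map_add]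
    rfl
  smul_mem' := by
    rintro z x ⟨hx, hx'⟩
    refine ⟨T.domain.smul_mem z hx, ?_⟩
    rw [smul_comm, ← hx', ← T.map_smul]
    rfl

/-- The `n`-th (`n ≥ 1`) nonzero eigenvalue of a positive operator `T`, in increasing order and
repeated according to multiplicity: the least `r > 0` such that the eigenspaces for eigenvalues in
`(0, r]` span a space of dimension at least `n`. It is `∞` if `T` has fewer than `n` nonzero
eigenvalues. -/
def positiveEigenvalue (T : H →ₗ.[ℂ] H) (n : ℕ) : ℝ≥0∞ :=
  ⨅ r : {r : ℝ // 0 < r ∧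
    (n : Cardinal) ≤ Module.rank ℂ (⨆ c ∈ Set.Ioc (0 : ℝ) r, eigenspace T c : Submodule ℂ H)},
    ENNReal.ofReal r.1

/-- `B` is the bounded operator given by the commutator `[T, a] = T a - a T`: the operator `a`
preserves the domain of `T`, and `T a x - a T x = B x` on this domain. -/
def IsBoundedCommutator (T : H →ₗ.[ℂ] H) (a B : H →L[ℂ] H) : Prop :=
  ∀ x : T.domain, ∃ h : a x ∈ T.domain, T ⟨a x, h⟩ - a (T x) = B x

/-- The commutator `[T, a]` is bounded. -/
def HasBoundedCommutator (T : H →ₗ.[ℂ] H) (a : H →L[ℂ] H) : Prop :=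
  ∃ B : H →L[ℂ] H, IsBoundedCommutator T a B

/-- The bounded operator `[T, a]`; it is uniquely determined when `T` is densely defined. -/
def commutator {T : H →ₗ.[ℂ] H} {a : H →L[ℂ] H} (h : HasBoundedCommutator T a) : H →L[ℂ] H :=
  h.choose

theorem commutator_eq {T : H →ₗ.[ℂ] H} {a B : H →L[ℂ] H} (hT : Dense (T.domain : Set H))
    (h : HasBoundedCommutator T a) (hB : IsBoundedCommutator T a B) : commutator h = B := by
  apply ContinuousLinearMap.coeFn_injective
  refine Continuous.ext_on hT (commutator h).continuous B.continuous fun x hx => ?_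
  obtain ⟨h₁, e₁⟩ := h.choose_spec ⟨x, hx⟩
  obtain ⟨h₂, e₂⟩ := hB ⟨x, hx⟩
  exact e₁.symm.trans e₂

variable [CompleteSpace H]

/-- The orthogonal projection onto the eigenspace `ker (T - c)`. (This eigenspace is already
closed when `T` is a closed operator.) -/
def eigenprojection (T : H →ₗ.[ℂ] H) (c : ℝ) : H →L[ℂ] H :=
  (eigenspace T c).topologicalClosure.starProjection

/-- The functional calculus `f(T) = ∑_c f(c) P_c` of a self-adjoint operator `T` that is
diagonalizable, where `P_c` is the orthogonal projection onto `ker (T - c)`; the domain of `f(T)`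
consists of all the vectors `x` for which `∑_c f(c) P_c x` converges in norm, unconditionally. -/
def functionalCalculus (T : H →ₗ.[ℂ] H) (f : ℝ → ℝ) : H →ₗ.[ℂ] H where
  domain :=
    { carrier := {x | Summable fun c : ℝ => (f c : ℂ) • eigenprojection T c x}
      zero_mem' := by simp
      add_mem' := by
        intro x y hx hy
        simpa [smul_add] using Summable.add hx hy
      smul_mem' := by
        intro z x hx
        simpa [smul_comm _ z] using Summable.const_smul z hx }
  toFun :=
    { toFun := fun x => ∑' c : ℝ, (f c : ℂ) • eigenprojection T c (x : H)
      map_add' := by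
        rintro ⟨x, hx⟩ ⟨y, hy⟩
        simpa [smul_add] using Summable.tsum_add hx hy
      map_smul' := by
        rintro z ⟨x, hx⟩
        simpa [smul_comm _ z] using Summable.tsum_const_smul z hx }

theorem eigenspace_orthogonalFamily {T : H →ₗ.[ℂ] H} (hT : IsSelfAdjoint T) :
    OrthogonalFamily ℂ (fun c : ℝ => (eigenspace T c).topologicalClosure)
      fun c => (eigenspace T c).topologicalClosure.subtypeₗᵢ := by
  apply OrthogonalFamily.of_pairwise
  intro c d hcd
  have key : eigenspace T c ⟂ eigenspace T d := by
    rw [Submodule.isOrtho_iff_inner_eq]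
    rintro x ⟨hx, hx'⟩ y ⟨hy, hy'⟩
    have hs := LinearPMap.adjoint_isFormalAdjoint (T := T) hT.dense_domain
    rw [LinearPMap.isSelfAdjoint_def.mp hT] at hs
    have e := hs ⟨x, hx⟩ ⟨y, hy⟩
    rw [hx', hy', inner_smul_left, inner_smul_right, Complex.conj_ofReal] at e
    have e' : ((c : ℂ) - d) * inner ℂ x y = 0 := by
      rw [sub_mul, sub_eq_zero]; exact e
    rcases mul_eq_zero.mp e' with h | h
    · exact absurd (by exact_mod_cast sub_eq_zero.mp h) hcd
    · exact h
  have h₁ : (eigenspace T c).topologicalClosure ≤ (eigenspace T d)ᗮ :=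
    Submodule.topologicalClosure_minimal _ key (Submodule.isClosed_orthogonal _)
  have h₂ : (eigenspace T d).topologicalClosure ≤ ((eigenspace T c).topologicalClosure)ᗮ :=
    Submodule.topologicalClosure_minimal _
      (Submodule.isOrtho_iff_le.mp (Submodule.IsOrtho.symm h₁)) (Submodule.isClosed_orthogonal _)
  exact Submodule.IsOrtho.symm h₂

theorem norm_sum_eigenprojection_le {T : H →ₗ.[ℂ] H} (hT : IsSelfAdjoint T) {f : ℝ → ℝ} {M : ℝ}
    (hM : ∀ c, |f c| ≤ M) (s : Finset ℝ) (x : H) :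
    ‖∑ c ∈ s, (f c : ℂ) • eigenprojection T c x‖ ^ 2 ≤ M ^ 2 * ‖x‖ ^ 2 ∧
      ∑ c ∈ s, ‖(f c : ℂ) • eigenprojection T c x‖ ^ 2 ≤ M ^ 2 * ‖x‖ ^ 2 := by
  have hO := eigenspace_orthogonalFamily hT
  have hsum : ∀ g : ℝ → ℂ, ‖∑ c ∈ s, g c • eigenprojection T c x‖ ^ 2
      = ∑ c ∈ s, ‖g c • eigenprojection T c x‖ ^ 2 := by
    intro g
    exact hO.norm_sum (fun c => g c • ((eigenspace T c).topologicalClosure.orthogonalProjectionOnto x)) s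
  have hbessel : ∑ c ∈ s, ‖eigenprojection T c x‖ ^ 2 ≤ ‖x‖ ^ 2 := by
    have h1 : ‖∑ c ∈ s, eigenprojection T c x‖ ^ 2 = ∑ c ∈ s, ‖eigenprojection T c x‖ ^ 2 := by
      simpa using hsum fun _ => 1
    have h2 : RCLike.re (inner ℂ (∑ c ∈ s, eigenprojection T c x) x)
        = ∑ c ∈ s, ‖eigenprojection T c x‖ ^ 2 := by
      rw [sum_inner, map_sum]
      refine Finset.sum_congr rfl fun c _ => ?_
      exact Submodule.re_inner_starProjection_eq_normSq _ x
    have h3 := (RCLike.re_le_norm _).trans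
      (norm_inner_le_norm (𝕜 := ℂ) (∑ c ∈ s, eigenprojection T c x) x)
    rw [h2, ← h1] at h3
    rw [← h1]
    nlinarith [norm_nonneg (∑ c ∈ s, eigenprojection T c x), norm_nonneg x,
      sq_nonneg (‖x‖ - ‖∑ c ∈ s, eigenprojection T c x‖)]
  have hle : ∑ c ∈ s, ‖(f c : ℂ) • eigenprojection T c x‖ ^ 2 ≤ M ^ 2 * ‖x‖ ^ 2 := by
    calc ∑ c ∈ s, ‖(f c : ℂ) • eigenprojection T c x‖ ^ 2
        ≤ ∑ c ∈ s, M ^ 2 * ‖eigenprojection T c x‖ ^ 2 := by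
          refine Finset.sum_le_sum fun c _ => ?_
          rw [norm_smul, mul_pow, Complex.norm_real, Real.norm_eq_abs]
          gcongr
          exact hM c
      _ ≤ M ^ 2 * ‖x‖ ^ 2 := by
          rw [← Finset.mul_sum]
          gcongr
  exact ⟨(hsum _).trans_le hle, hle⟩

theorem functionalCalculus_domain_eq_top {T : H →ₗ.[ℂ] H} (hT : IsSelfAdjoint T) {f : ℝ → ℝ}
    {M : ℝ} (hM : ∀ c, |f c| ≤ M) : (functionalCalculus T f).domain = ⊤ := by
  rw [Submodule.eq_top_iff']
  intro x
  have h := (eigenspace_orthogonalFamily hT).summable_iff_norm_sq_summable fun c =>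
    (f c : ℂ) • ((eigenspace T c).topologicalClosure.orthogonalProjectionOnto x)
  refine h.mpr ?_
  exact summable_of_sum_le (fun c => sq_nonneg _)
    fun s => (norm_sum_eigenprojection_le hT hM s x).2

/-- The functional calculus `f(T)` for a bounded function `f`, as a bounded operator. -/
def boundedFunctionalCalculus {T : H →ₗ.[ℂ] H} (hT : IsSelfAdjoint T) (f : ℝ → ℝ) {M : ℝ}
    (hM : ∀ c, |f c| ≤ M) : H →L[ℂ] H :=
  LinearMap.mkContinuous
    ((functionalCalculus T f).toFun ∘ₗ
      LinearMap.codRestrict _ LinearMap.id fun x => by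
        rw [functionalCalculus_domain_eq_top hT hM]; trivial) M (by
    intro x
    have hM0 : 0 ≤ M := (abs_nonneg _).trans (hM 0)
    have hx : x ∈ (functionalCalculus T f).domain := by
      rw [functionalCalculus_domain_eq_top hT hM]; trivial
    have hs : Summable fun c : ℝ => (f c : ℂ) • eigenprojection T c x := hx
    refine le_of_tendsto hs.hasSum.norm (Filter.Eventually.of_forall fun s => ?_)
    have h := (norm_sum_eigenprojection_le hT hM s x).1
    rw [← mul_pow] at h
    exact le_of_sq_le_sq h (by positivity))

/-- The defining formula `f(T) x = ∑_c f(c) P_c x`. -/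
theorem boundedFunctionalCalculus_apply {T : H →ₗ.[ℂ] H} (hT : IsSelfAdjoint T) (f : ℝ → ℝ)
    {M : ℝ} (hM : ∀ c, |f c| ≤ M) (x : H) :
    boundedFunctionalCalculus hT f hM x = ∑' c : ℝ, (f c : ℂ) • eigenprojection T c x :=
  rfl

/-- The operator `D` has a compact inverse on the orthogonal complement of its kernel: there is a
compact operator `K` which maps `(ker D)ᗮ` into itself and satisfies `D K y = y` for all `y` in
`(ker D)ᗮ`. -/
def HasCompactInverseOffKernel (D : H →ₗ.[ℂ] H) : Prop :=
  ∃ K : H →L[ℂ] H, IsCompactOperator K ∧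
    ∀ y ∈ (eigenspace D 0)ᗮ, K y ∈ (eigenspace D 0)ᗮ ∧
      ∃ h : K y ∈ D.domain, D ⟨K y, h⟩ = y

theorem abs_div_sqrt_one_add_sq_le (c : ℝ) : |c / Real.sqrt (1 + c ^ 2)| ≤ 1 := by
  have h : 0 < Real.sqrt (1 + c ^ 2) := Real.sqrt_pos.mpr (by positivity)
  rw [abs_div, abs_of_pos h, div_le_one h]
  exact Real.abs_le_sqrt (by linarith)

end Operators

end SpectralTriple

/-- An essentially discrete spectral triple `(A, H, D)` on the Hilbert space `H`: a `*`-algebra `A`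
of bounded operators on `H` and a self-adjoint, possibly unbounded, operator `D` on `H` with
compact inverse on the orthogonal complement of its kernel, such that `[D, a]` is bounded for every
`a ∈ A`. The kernel of `D` may be infinite dimensional. -/
structure EssentiallyDiscreteSpectralTriple (H : Type*) [NormedAddCommGroup H]
    [InnerProductSpace ℂ H] [CompleteSpace H] where
  A : NonUnitalStarSubalgebra ℂ (H →L[ℂ] H)
  D : H →ₗ.[ℂ] H
  isSelfAdjoint_D : IsSelfAdjoint D
  hasCompactInverse : SpectralTriple.HasCompactInverseOffKernel D
  hasBoundedCommutator : ∀ a ∈ A, SpectralTriple.HasBoundedCommutator D a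

namespace EssentiallyDiscreteSpectralTriple

variable {H : Type*} [NormedAddCommGroup H] [InnerProductSpace ℂ H] [CompleteSpace H]

/-- The operator `|D|`. -/
def absD (X : EssentiallyDiscreteSpectralTriple H) : H →ₗ.[ℂ] H :=
  SpectralTriple.functionalCalculus X.D fun c => |c|

/-- The operator `F = P₀ + D (1 + D²)^{-1/2}`, where `P₀` is the orthogonal projection onto
`ker D`. -/
def F (X : EssentiallyDiscreteSpectralTriple H) : H →L[ℂ] H :=
  SpectralTriple.eigenprojection X.D 0 +
    SpectralTriple.boundedFunctionalCalculus X.isSelfAdjoint_D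
      (fun c => c / Real.sqrt (1 + c ^ 2)) SpectralTriple.abs_div_sqrt_one_add_sq_le

/-- The quantum differential `i [F, a] = i (F a - a F)`. -/
def quantumDifferential (X : EssentiallyDiscreteSpectralTriple H) (a : H →L[ℂ] H) : H →L[ℂ] H :=
  Complex.I • (X.F * a - a * X.F)

end EssentiallyDiscreteSpectralTriple

end

namespace SpectralTriple

/-! ### Singular values and compact perturbations of the identity -/

section SingularValues

open Filter Topology

variable {H : Type*} [NormedAddCommGroup H] [InnerProductSpace ℂ H]

/-! Everything rests on one estimate, `singularValue_le_norm_sub`: an operator of rank at most `k`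
bounds `μ_k(A)` by its distance to `A`.

For (i), take `E_k` of dimension at most `k` with `‖T E_k^⊥‖` nearly equal to `μ_k(T)`, and let `P`
project onto `(ker T)^⊥`. Since `T = TP`, one gets `μ_k(T(1+σ)) ≤ ‖T E_k^⊥ (1 + Pσ)‖ ≤ ‖T E_k^⊥‖ (1
+ ‖E_k^⊥ P σ‖)`. The operators `E_k^⊥ P` tend strongly to `0`: on the range of `T*`, which is dense
in `(ker T)^⊥`, the norm of `E_k^⊥ T* y` is at most `‖T E_k^⊥‖ ‖y‖`. Compactness of `σ` turns this
into norm convergence (`tendsto_norm_mul_compact`). For the lower bound, split `σ = R + τ` with `R`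
of finite rank `d` and `‖τ‖ < 1`. Then `1 + τ` has an inverse of the form `1 + compact`, so the
upper bound applied to `T(1+τ)` and this inverse recovers `T`; removing `TR` shifts the index by
`d`.

For (ii), the compact inverse makes the eigenvectors of `D` total (`exists_compact_inverse`), so
identities between bounded operators can be checked on matrix entries. There `[D,a]`, `[|D|,a]` and
`[F,a]` multiply the entry of `a` by `c - d`, `|c| - |d|` and `φ(c) - φ(d)`. With `m =
λ_{k+1}(|D|)`, let `Q` project onto the kernel of `D` and the eigenvalues with `|c| ≥ m`. As `1 - Q`
has rank at most `k`, compressing by `Q` on both sides is a perturbation of rank at most `2k`. On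
the range of `Q`, `φ` differs from a sign function by at most `m⁻²`, and differences of signs are
expressed through `c - d` and `|c| - |d|` divided by an eigenvalue of modulus at least `m`
(`cutoff_mul_phase_sub`). Counting terms gives `5 ‖[D,a]‖ + ‖[|D|,a]‖` times `m⁻¹`; the `m⁻²`
remainder is absorbed in `ε_k` because `m → ∞`, in the sense that `m⁻¹ → 0`. -/

theorem rank_starProjection (E : Submodule ℂ H) [E.HasOrthogonalProjection] :
    (E.starProjection : H →ₗ[ℂ] H).rank = Module.rank ℂ E := by
  have h := Submodule.range_starProjection E
  unfold LinearMap.rank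
  rw [h]

theorem comp_starProjection_orthogonal (A : H →L[ℂ] H) (E : Submodule ℂ H)
    [E.HasOrthogonalProjection] :
    A ∘L Eᗮ.starProjection = A - A ∘L E.starProjection := by
  ext x
  simp [Submodule.starProjection_orthogonal_val]

theorem hasOrthogonalProjection_of_rank_le {E : Submodule ℂ H} {k : ℕ}
    (hE : Module.rank ℂ E ≤ k) : E.HasOrthogonalProjection := by
  have : FiniteDimensional ℂ E :=
    Module.rank_lt_aleph0_iff.mp (hE.trans_lt (Cardinal.natCast_lt_aleph0))
  infer_instance

theorem rank_mul_le_left (A B : H →L[ℂ] H) :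
    ((A * B : H →L[ℂ] H) : H →ₗ[ℂ] H).rank ≤ (A : H →ₗ[ℂ] H).rank :=
  LinearMap.rank_comp_le_left (B : H →ₗ[ℂ] H) (A : H →ₗ[ℂ] H)

theorem rank_mul_le_right (A B : H →L[ℂ] H) :
    ((A * B : H →L[ℂ] H) : H →ₗ[ℂ] H).rank ≤ (B : H →ₗ[ℂ] H).rank :=
  LinearMap.rank_comp_le_right (B : H →ₗ[ℂ] H) (A : H →ₗ[ℂ] H)

theorem rank_clm_add_le (A B : H →L[ℂ] H) :
    ((A + B : H →L[ℂ] H) : H →ₗ[ℂ] H).rank ≤ (A : H →ₗ[ℂ] H).rank + (B : H →ₗ[ℂ] H).rank :=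
  LinearMap.rank_add_le (A : H →ₗ[ℂ] H) (B : H →ₗ[ℂ] H)

/-- The image of the unit ball under a compact operator is approximated by a finite set. -/
theorem exists_finite_net {K : H →L[ℂ] H} (hK : IsCompactOperator K) {ε : ℝ} (hε : 0 < ε) :
    ∃ t : Set H, t.Finite ∧ ∀ x : H, ‖x‖ ≤ 1 → ∃ y ∈ t, ‖K x - y‖ < ε := by
  have hc := IsCompactOperator.isCompact_closure_image_closedBall (f := (K : H →ₗ[ℂ] H)) hK 1
  obtain ⟨t, ht, hsub⟩ := Metric.totallyBounded_iff.mp hc.totallyBounded ε hε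
  refine ⟨t, ht, fun x hx => ?_⟩
  have hmem := hsub (subset_closure ⟨x, by simpa using hx, rfl⟩)
  obtain ⟨y, hy, hxy⟩ := Set.mem_iUnion₂.mp hmem
  exact ⟨y, hy, by simpa [dist_eq_norm] using hxy⟩

/-- A bounded sequence of operators which converges strongly to `0` converges to `0` in norm after
composition with a compact operator. -/
theorem tendsto_norm_mul_compact {A : ℕ → H →L[ℂ] H} {M : ℝ} (hA : ∀ n, ‖A n‖ ≤ M)
    {K : H →L[ℂ] H} (hK : IsCompactOperator K)
    (h0 : ∀ x, Tendsto (fun n => A n x) atTop (𝓝 0)) :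
    Tendsto (fun n => ‖A n * K‖) atTop (𝓝 0) := by
  have hM : 0 ≤ M := (norm_nonneg _).trans (hA 0)
  rw [Metric.tendsto_atTop]
  intro ε hε
  obtain ⟨t, ht, hnet⟩ := exists_finite_net hK (ε := ε / (4 * (M + 1))) (by positivity)
  have hev : ∀ᶠ n in atTop, ∀ y ∈ t, ‖A n y‖ < ε / 4 := by
    rw [Filter.eventually_all_finite ht]
    intro y _
    have := (h0 y).norm
    rw [norm_zero] at this
    exact this.eventually_lt_const (by positivity)
  obtain ⟨N, hN⟩ := eventually_atTop.mp hev
  refine ⟨N, fun n hn => ?_⟩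
  rw [Real.dist_eq, sub_zero, abs_norm]
  have : ‖A n * K‖ ≤ ε / 2 := by
    refine ContinuousLinearMap.opNorm_le_of_unit_norm (by positivity) fun x hx => ?_
    obtain ⟨y, hy, hxy⟩ := hnet x hx.le
    have e : (A n * K) x = A n (K x - y) + A n y := by simp
    rw [e]
    have h1 : ‖A n (K x - y)‖ ≤ M * (ε / (4 * (M + 1))) :=
      ((A n).le_opNorm _).trans (mul_le_mul (hA n) hxy.le (norm_nonneg _) hM)
    have h2 : M * (ε / (4 * (M + 1))) ≤ ε / 4 := by
      rw [mul_div_assoc', div_le_div_iff₀ (by positivity) (by positivity)]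
      nlinarith
    have h3 := hN n hn y hy
    exact (norm_add_le _ _).trans (by linarith)
  linarith

/-- Projecting `K` onto the span of a finite net of the image of the unit ball moves each `K x` no
further than its nearest net point. -/
theorem exists_finiteDimensional_norm_sub_le {K : H →L[ℂ] H} (hK : IsCompactOperator K)
    {ε : ℝ} (hε : 0 < ε) :
    ∃ R : H →L[ℂ] H, (∃ d : ℕ, (R : H →ₗ[ℂ] H).rank ≤ d) ∧ IsCompactOperator R ∧
      ‖K - R‖ ≤ ε := by
  obtain ⟨t, ht, hnet⟩ := exists_finite_net hK hε
  set E := Submodule.span ℂ t with hE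
  have : FiniteDimensional ℂ E := FiniteDimensional.span_of_finite ℂ ht
  refine ⟨E.starProjection * K, ⟨Module.finrank ℂ E, ?_⟩, hK.clm_comp E.starProjection, ?_⟩
  · refine (rank_mul_le_left _ _).trans ?_
    rw [rank_starProjection, Module.finrank_eq_rank]
  · refine ContinuousLinearMap.opNorm_le_of_unit_norm hε.le fun x hx => ?_
    obtain ⟨y, hy, hxy⟩ := hnet x hx.le
    refine le_trans ?_ hxy.le
    have hmin := Submodule.starProjection_minimal (U := E) (K x)
    rw [sub_apply, mul_apply_eq_comp, hmin]
    exact ciInf_le (f := fun w : E => ‖K x - w‖) ⟨0, by rintro _ ⟨w, rfl⟩; exact norm_nonneg _⟩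
      ⟨y, Submodule.subset_span hy⟩

variable [CompleteSpace H]

theorem norm_starProjection_orthogonal_comp_le (E : Submodule ℂ H) (A : H →L[ℂ] H) :
    ‖A ∘L Eᗮ.starProjection‖ ≤ ‖A‖ :=
  (A.opNorm_comp_le _).trans
    (mul_le_of_le_one_right (norm_nonneg _) (Submodule.starProjection_norm_le _))

theorem singularValue_set_bddBelow (k : ℕ) (T : H →L[ℂ] H) :
    BddBelow {r : ℝ | ∃ E : Submodule ℂ H, Module.rank ℂ E ≤ k ∧
      r = ‖T ∘L Eᗮ.starProjection‖} :=
  ⟨0, by rintro r ⟨E, -, rfl⟩; exact norm_nonneg _⟩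

theorem singularValue_set_nonempty (k : ℕ) (T : H →L[ℂ] H) :
    {r : ℝ | ∃ E : Submodule ℂ H, Module.rank ℂ E ≤ k ∧
      r = ‖T ∘L Eᗮ.starProjection‖}.Nonempty :=
  ⟨_, ⊥, by simp, rfl⟩

theorem singularValue_nonneg (k : ℕ) (T : H →L[ℂ] H) : 0 ≤ singularValue k T :=
  Real.sInf_nonneg (by rintro r ⟨E, -, rfl⟩; exact norm_nonneg _)

theorem singularValue_le {k : ℕ} (T : H →L[ℂ] H) {E : Submodule ℂ H}
    (hE : Module.rank ℂ E ≤ k) : singularValue k T ≤ ‖T ∘L Eᗮ.starProjection‖ :=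
  csInf_le (singularValue_set_bddBelow k T) ⟨E, hE, rfl⟩

theorem exists_lt_of_singularValue_lt {k : ℕ} {T : H →L[ℂ] H} {r : ℝ}
    (h : singularValue k T < r) :
    ∃ E : Submodule ℂ H, Module.rank ℂ E ≤ k ∧ ‖T ∘L Eᗮ.starProjection‖ < r := by
  obtain ⟨_, ⟨E, hE, rfl⟩, hr⟩ := exists_lt_of_csInf_lt (singularValue_set_nonempty k T) h
  exact ⟨E, hE, hr⟩

/-- Singular values are bounded by the distance to operators of small rank. -/
theorem singularValue_le_norm_sub {k : ℕ} (A R : H →L[ℂ] H)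
    (hR : (R : H →ₗ[ℂ] H).rank ≤ k) : singularValue k A ≤ ‖A - R‖ := by
  -- `R` is injective on `(ker R)^⊥`, so this subspace has dimension at most `rank R` and competes
  -- in the infimum; on its complement `ker R`, `A` and `A - R` agree.
  set N : Submodule ℂ H := (R : H →ₗ[ℂ] H).ker with hN
  have hNc : IsClosed (N : Set H) := R.isClosed_ker
  have hr : Module.rank ℂ (Nᗮ : Submodule ℂ H) ≤ k := by
    refine le_trans ?_ hR
    refine LinearMap.rank_le_of_injective
      ((R : H →ₗ[ℂ] H).rangeRestrict ∘ₗ Nᗮ.subtype) ?_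
    rw [← LinearMap.ker_eq_bot, LinearMap.ker_eq_bot']
    rintro ⟨x, hx⟩ h0
    have h1 : x ∈ N := by
      have := congrArg Subtype.val h0
      simpa [hN] using this
    exact Subtype.ext (by simpa using N.inner_right_of_mem_orthogonal h1 hx)
  refine (singularValue_le A hr).trans ?_
  have h2 : Nᗮᗮ = N := by
    rw [Submodule.orthogonal_orthogonal_eq_closure, hNc.submodule_topologicalClosure_eq]
  have h3 : A ∘L Nᗮᗮ.starProjection = (A - R) ∘L Nᗮᗮ.starProjection := by
    ext x
    have h4 : R (Nᗮᗮ.starProjection x) = 0 := h2.le (Nᗮᗮ.starProjection_apply_mem x)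
    change A (Nᗮᗮ.starProjection x) = A (Nᗮᗮ.starProjection x) - R (Nᗮᗮ.starProjection x)
    rw [h4, sub_zero]
  rw [h3]
  exact norm_starProjection_orthogonal_comp_le _ _

/-- `μ_k(TB) ≤ ‖T E^⊥ B‖` for every subspace `E` of dimension at most `k`. -/
theorem singularValue_mul_le_norm {k : ℕ} (T B : H →L[ℂ] H) {E : Submodule ℂ H}
    (hE : Module.rank ℂ E ≤ k) :
    singularValue k (T * B) ≤ ‖T ∘L Eᗮ.starProjection * B‖ := by
  have := hasOrthogonalProjection_of_rank_le hE
  have hR : ((T * (E.starProjection * B) : H →L[ℂ] H) : H →ₗ[ℂ] H).rank ≤ k :=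
    (rank_mul_le_right _ _).trans ((rank_mul_le_left _ _).trans (by rwa [rank_starProjection]))
  refine (singularValue_le_norm_sub (T * B) _ hR).trans_eq ?_
  rw [comp_starProjection_orthogonal, sub_mul]
  rfl

theorem singularValue_mul_le (k : ℕ) (T B : H →L[ℂ] H) :
    singularValue k (T * B) ≤ singularValue k T * ‖B‖ := by
  refine le_of_forall_pos_le_add fun ε hε => ?_
  have hpos : 0 < ‖B‖ + 1 := by positivity
  obtain ⟨E, hE, hlt⟩ := exists_lt_of_singularValue_lt
    (lt_add_of_pos_right (singularValue k T) (div_pos hε hpos))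
  calc singularValue k (T * B) ≤ ‖T ∘L Eᗮ.starProjection * B‖ := singularValue_mul_le_norm T B hE
    _ ≤ ‖T ∘L Eᗮ.starProjection‖ * ‖B‖ := norm_mul_le _ _
    _ ≤ (singularValue k T + ε / (‖B‖ + 1)) * ‖B‖ := by gcongr
    _ = singularValue k T * ‖B‖ + ε / (‖B‖ + 1) * ‖B‖ := by ring
    _ ≤ singularValue k T * ‖B‖ + ε / (‖B‖ + 1) * (‖B‖ + 1) := by gcongr; linarith
    _ = _ := by rw [div_mul_cancel₀ _ hpos.ne']

/-- If `E` competes for `μ_k(A)`, then `A E + R` has rank at most `k + d` and its difference from `A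
+ R` is `A E^⊥`. -/
theorem singularValue_add_rank_le (k d : ℕ) (A R : H →L[ℂ] H)
    (hR : (R : H →ₗ[ℂ] H).rank ≤ d) :
    singularValue (k + d) (A + R) ≤ singularValue k A := by
  refine le_csInf (singularValue_set_nonempty k A) ?_
  rintro _ ⟨E, hE, rfl⟩
  have := hasOrthogonalProjection_of_rank_le hE
  have h : ((A * E.starProjection + R : H →L[ℂ] H) : H →ₗ[ℂ] H).rank ≤ (k + d : ℕ) := by
    refine (rank_clm_add_le _ _).trans ?_
    push_cast
    refine add_le_add ((rank_mul_le_right _ _).trans ?_) hR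
    rwa [rank_starProjection]
  refine (singularValue_le_norm_sub (A + R) _ h).trans_eq ?_
  rw [comp_starProjection_orthogonal, add_sub_add_right_eq_sub]
  rfl

theorem singularValue_antitone (T : H →L[ℂ] H) : Antitone fun k => singularValue k T := by
  intro k l hkl
  refine le_csInf (singularValue_set_nonempty k T) ?_
  rintro _ ⟨E, hE, rfl⟩
  exact singularValue_le T (hE.trans (by exact_mod_cast hkl))

theorem tendsto_singularValue {T : H →L[ℂ] H} (hT : IsCompactOperator T) :
    Tendsto (fun k => singularValue k T) atTop (𝓝 0) := by
  rw [Metric.tendsto_atTop]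
  intro ε hε
  obtain ⟨R, ⟨d, hd⟩, -, hR⟩ := exists_finiteDimensional_norm_sub_le hT (half_pos hε)
  refine ⟨d, fun n hn => ?_⟩
  rw [Real.dist_eq, sub_zero, abs_of_nonneg (singularValue_nonneg _ _)]
  have h1 := singularValue_antitone T hn
  have h2 := singularValue_le_norm_sub T R hd
  simp only at h1
  linarith

/-- Upper bound for the singular values of `T(1 + σ)`, for `T` and `σ` compact. -/
theorem exists_singularValue_mul_one_add_le {T σ : H →L[ℂ] H} (hT : IsCompactOperator T)
    (hσ : IsCompactOperator σ) :
    ∃ ε : ℕ → ℝ, Tendsto ε atTop (𝓝 0) ∧ ∀ k : ℕ,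
      singularValue k (T * (1 + σ)) ≤ (1 + ε k) * singularValue k T := by
  -- The infimum need not be known to be attained. The additive error gives `‖T E_k^⊥‖ → 0`; the
  -- multiplicative one is needed for the final bound and makes sense only when `μ_k(T) > 0`.
  have hex : ∀ k : ℕ, ∃ E : Submodule ℂ H, Module.rank ℂ E ≤ k ∧
      ‖T ∘L Eᗮ.starProjection‖ ≤ singularValue k T + 1 / (k + 1) ∧
      (0 < singularValue k T →
        ‖T ∘L Eᗮ.starProjection‖ ≤ (1 + 1 / (k + 1)) * singularValue k T) := by
    intro k
    have hk : (0 : ℝ) < 1 / (k + 1) := by positivity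
    rcases (singularValue_nonneg k T).eq_or_lt with h | h
    · obtain ⟨E, hE, hlt⟩ := exists_lt_of_singularValue_lt (lt_add_of_pos_right (singularValue k T) hk)
      exact ⟨E, hE, hlt.le, fun h' => absurd h' (by rw [← h]; exact lt_irrefl _)⟩
    · have hm : 0 < min (1 / ((k : ℝ) + 1)) (1 / (k + 1) * singularValue k T) :=
        lt_min hk (mul_pos hk h)
      obtain ⟨E, hE, hlt⟩ := exists_lt_of_singularValue_lt (lt_add_of_pos_right (singularValue k T) hm)
      refine ⟨E, hE, hlt.le.trans (by gcongr; exact min_le_left _ _), fun _ => hlt.le.trans ?_⟩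
      rw [add_mul, one_mul]
      gcongr
      exact min_le_right _ _
  choose E hE hE1 hE2 using hex
  set P : H →L[ℂ] H := ((T : H →ₗ[ℂ] H).ker)ᗮ.starProjection with hP
  have hker : IsClosed ((T : H →ₗ[ℂ] H).ker : Set H) := T.isClosed_ker
  have hTP : T * P = T := by
    ext x
    have : CompleteSpace (T : H →ₗ[ℂ] H).ker := hker.completeSpace_coe
    have h1 : (T : H →ₗ[ℂ] H).ker.starProjection x ∈ (T : H →ₗ[ℂ] H).ker :=
      Submodule.starProjection_apply_mem _ _
    have h2 : T ((T : H →ₗ[ℂ] H).ker.starProjection x) = 0 := h1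
    rw [mul_apply_eq_comp, hP, Submodule.starProjection_orthogonal_val, map_sub, h2,
      sub_zero]
  have hnorm : ∀ k, ‖((E k)ᗮ.starProjection : H →L[ℂ] H)‖ ≤ 1 :=
    fun k => Submodule.starProjection_norm_le _
  have htail : Tendsto (fun k : ℕ => 1 / ((k : ℝ) + 1)) atTop (𝓝 0) :=
    tendsto_one_div_add_atTop_nhds_zero_nat
  have hstrong : ∀ x, Tendsto (fun k => ((E k)ᗮ.starProjection * P) x) atTop (𝓝 0) := by
    have hclosed : ∀ z ∈ closure ((T.adjoint : H →ₗ[ℂ] H).range : Set H),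
        Tendsto (fun k => (E k)ᗮ.starProjection z) atTop (𝓝 0) := by
      intro z hz
      rw [Metric.tendsto_atTop]
      intro ε hε
      obtain ⟨_, ⟨y, rfl⟩, hy⟩ := Metric.mem_closure_iff.mp hz (ε / 2) (half_pos hε)
      have hlim : Tendsto (fun k : ℕ => (singularValue k T + 1 / ((k : ℝ) + 1)) * ‖y‖) atTop (𝓝 0) := by
        simpa using ((tendsto_singularValue hT).add htail).mul_const ‖y‖
      obtain ⟨N, hN⟩ := eventually_atTop.mp (hlim.eventually_lt_const (half_pos hε))
      refine ⟨N, fun k hk => ?_⟩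
      -- `E^⊥ T*` is the adjoint of `T E^⊥` and has the same norm.
      have hadj : ‖(E k)ᗮ.starProjection (T.adjoint y)‖ ≤ ‖T ∘L (E k)ᗮ.starProjection‖ * ‖y‖ := by
        have e : (E k)ᗮ.starProjection ∘L T.adjoint = (T ∘L (E k)ᗮ.starProjection).adjoint := by
          rw [ContinuousLinearMap.adjoint_comp]
          congr 1
          exact ((isSelfAdjoint_starProjection (E k)ᗮ).star_eq).symm
        have := ((E k)ᗮ.starProjection ∘L T.adjoint).le_opNorm y
        rw [e, LinearIsometryEquiv.norm_map] at this
        rw [← e] at this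
        exact this
      have h1 : ‖(E k)ᗮ.starProjection (T.adjoint y)‖ < ε / 2 :=
        (hadj.trans (by gcongr; exact hE1 k)).trans_lt (hN k hk)
      have h2 : ‖(E k)ᗮ.starProjection (z - T.adjoint y)‖ < ε / 2 := by
        refine (Submodule.norm_starProjection_apply_le _ _).trans_lt ?_
        rw [← dist_eq_norm]; exact hy
      rw [dist_zero_right]
      calc ‖(E k)ᗮ.starProjection z‖
          = ‖(E k)ᗮ.starProjection (z - T.adjoint y) + (E k)ᗮ.starProjection (T.adjoint y)‖ := by
            rw [← map_add, sub_add_cancel]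
        _ < ε := (norm_add_le _ _).trans_lt (by linarith)
    intro x
    refine hclosed (P x) ?_
    have hx : P x ∈ ((T : H →ₗ[ℂ] H).ker)ᗮ := Submodule.starProjection_apply_mem _ _
    have := T.orthogonal_ker
    rw [this] at hx
    exact hx
  have hcomp := tendsto_norm_mul_compact (A := fun k => (E k)ᗮ.starProjection * P) (M := 1)
    (fun k => (norm_mul_le _ _).trans (mul_le_one₀ (hnorm k) (norm_nonneg _)
      (Submodule.starProjection_norm_le _))) hσ hstrong
  refine ⟨fun k => (1 + 1 / ((k : ℝ) + 1)) * (1 + ‖(E k)ᗮ.starProjection * P * σ‖) - 1, ?_, ?_⟩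
  · simpa using (((htail.const_add 1).mul (hcomp.const_add 1)).sub_const 1)
  · intro k
    -- If `μ_k(T) = 0`, then `μ_k(T(1+σ)) ≤ μ_k(T) ‖1+σ‖` already gives zero.
    rcases (singularValue_nonneg k T).eq_or_lt with h | h
    · have := singularValue_mul_le k T (1 + σ)
      rw [← h, zero_mul] at this
      rwa [← h, mul_zero]
    · have e : T * (1 + σ) = T * (1 + P * σ) := by
        rw [mul_add, mul_add, ← mul_assoc, hTP]
      have e2 : T ∘L (E k)ᗮ.starProjection * (1 + P * σ)
          = T ∘L (E k)ᗮ.starProjection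
            + (T ∘L (E k)ᗮ.starProjection) * ((E k)ᗮ.starProjection * P * σ) := by
        rw [mul_add, mul_one]
        congr 1
        have hi : ((E k)ᗮ.starProjection : H →L[ℂ] H) * (E k)ᗮ.starProjection
            = (E k)ᗮ.starProjection := (E k)ᗮ.isIdempotentElem_starProjection
        change T * (E k)ᗮ.starProjection * (P * σ)
          = T * (E k)ᗮ.starProjection * ((E k)ᗮ.starProjection * P * σ)
        simp only [mul_assoc]
        rw [← mul_assoc ((E k)ᗮ.starProjection) ((E k)ᗮ.starProjection), hi]
      rw [e]
      calc singularValue k (T * (1 + P * σ))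
          ≤ ‖T ∘L (E k)ᗮ.starProjection * (1 + P * σ)‖ := singularValue_mul_le_norm _ _ (hE k)
        _ ≤ ‖T ∘L (E k)ᗮ.starProjection‖
            + ‖T ∘L (E k)ᗮ.starProjection‖ * ‖(E k)ᗮ.starProjection * P * σ‖ := by
            rw [e2]
            exact (norm_add_le _ _).trans (by gcongr; exact norm_mul_le _ _)
        _ = ‖T ∘L (E k)ᗮ.starProjection‖ * (1 + ‖(E k)ᗮ.starProjection * P * σ‖) := by ring
        _ ≤ (1 + 1 / ((k : ℝ) + 1)) * singularValue k T
              * (1 + ‖(E k)ᗮ.starProjection * P * σ‖) := by gcongr; exact hE2 k h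
        _ = _ := by ring

/-- Lower bound for the singular values of `T(1 + σ)`, for `T` and `σ` compact. -/
theorem exists_le_singularValue_mul_one_add {T σ : H →L[ℂ] H} (hT : IsCompactOperator T)
    (hσ : IsCompactOperator σ) :
    ∃ (d : ℕ) (ε : ℕ → ℝ), Tendsto ε atTop (𝓝 0) ∧ ∀ k : ℕ,
      (1 - ε k) * singularValue (k + d) T ≤ singularValue k (T * (1 + σ)) := by
  obtain ⟨R, ⟨d, hd⟩, hRc, hR⟩ := exists_finiteDimensional_norm_sub_le hσ (ε := 1 / 2) (by norm_num)
  set τ := σ - R with hτ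
  have hτc : IsCompactOperator τ := hσ.sub hRc
  have hunit : IsUnit (1 + τ) := by
    have : ‖-τ‖ < 1 := by rw [norm_neg]; linarith
    simpa using (Units.oneSub (-τ) this).isUnit
  obtain ⟨u, hu⟩ := hunit
  set S : H →L[ℂ] H := ((u⁻¹ : (H →L[ℂ] H)ˣ) : H →L[ℂ] H) with hS
  have h1 : (1 + τ) * S = 1 := by rw [← hu, hS]; exact u.mul_inv
  -- The inverse of `1 + τ` is again a compact perturbation of the identity, so the upper bound
  -- applies to it.
  have hS' : S = 1 + -(τ * S) := by
    rw [add_mul, one_mul] at h1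
    rw [← h1]; abel
  have hc : IsCompactOperator (-(τ * S) : H →L[ℂ] H) := (hτc.comp_clm S).neg
  have hTτ : IsCompactOperator (T * (1 + τ) : H →L[ℂ] H) := hT.comp_clm _
  obtain ⟨η, hη, hle⟩ := exists_singularValue_mul_one_add_le hTτ hc
  have hT' : T * (1 + τ) * (1 + -(τ * S)) = T := by
    rw [← hS', mul_assoc, h1, mul_one]
  rw [hT'] at hle
  have hη0 : Tendsto (fun k => |η (k + d)|) atTop (𝓝 0) := by
    simpa using ((tendsto_add_atTop_iff_nat d).mpr hη).abs
  -- Chosen so that `1 - ε_k = 1 / (1 + |η_{k+d}|)`; the absolute value keeps the denominator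
  -- positive, since the sign of `η` is not controlled.
  refine ⟨d, fun k => |η (k + d)| / (1 + |η (k + d)|), ?_, fun k => ?_⟩
  · have := hη0.div (hη0.const_add 1) (by norm_num)
    rw [add_zero, zero_div] at this
    exact this
  · have hpos : 0 < 1 + |η (k + d)| := by positivity
    have h2 : T * (1 + τ) = T * (1 + σ) + T * (-R) := by
      rw [hτ, ← mul_add]; congr 1; abel
    have hrank : ((T * (-R) : H →L[ℂ] H) : H →ₗ[ℂ] H).rank ≤ d := by
      refine le_trans ?_ hd
      have : T * (-R) = (-T) * R := by simp
      rw [this]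
      exact rank_mul_le_right _ _
    have h3 := singularValue_add_rank_le k d (T * (1 + σ)) _ hrank
    rw [← h2] at h3
    have h4 : singularValue (k + d) T ≤ (1 + |η (k + d)|) * singularValue k (T * (1 + σ)) :=
      (hle (k + d)).trans (mul_le_mul (by gcongr; exact le_abs_self _) h3
        (singularValue_nonneg _ _) hpos.le)
    have h5 : 1 - |η (k + d)| / (1 + |η (k + d)|) = (1 + |η (k + d)|)⁻¹ := by
      field_simp
      ring
    rw [h5, inv_mul_le_iff₀ hpos]
    exact h4

end SingularValues

/-! ### Functional calculus on eigenvectors and diagonalizability -/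

section FunctionalCalculus

variable {H : Type*} [NormedAddCommGroup H] [InnerProductSpace ℂ H]

theorem mem_eigenspace_iff {T : H →ₗ.[ℂ] H} {c : ℝ} {x : H} :
    x ∈ eigenspace T c ↔ ∃ h : x ∈ T.domain, T ⟨x, h⟩ = (c : ℂ) • x := Iff.rfl

theorem eq_of_inner_eigenvector {T : H →ₗ.[ℂ] H} (htot : (⨆ c, eigenspace T c)ᗮ = ⊥) {x y : H}
    (h : ∀ c, ∀ e ∈ eigenspace T c, inner ℂ e x = inner ℂ e y) : x = y := by
  have hx : x - y ∈ (⨆ c, eigenspace T c)ᗮ := by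
    rw [← Submodule.iInf_orthogonal, Submodule.mem_iInf]
    intro c
    rw [Submodule.mem_orthogonal]
    intro e he
    rw [inner_sub_right, h c e he, sub_self]
  rw [htot, Submodule.mem_bot] at hx
  exact sub_eq_zero.mp hx

variable [CompleteSpace H] {T : H →ₗ.[ℂ] H}

theorem isClosed_eigenspace (hT : IsSelfAdjoint T) (c : ℝ) :
    IsClosed (eigenspace T c : Set H) := by
  have h : (eigenspace T c : Set H) = (fun x : H => (x, (c : ℂ) • x)) ⁻¹' T.graph := by
    ext x
    simp only [SetLike.mem_coe, Set.mem_preimage, LinearPMap.mem_graph_iff, mem_eigenspace_iff]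
    constructor
    · rintro ⟨h, hx⟩
      exact ⟨⟨x, h⟩, rfl, hx⟩
    · rintro ⟨⟨y, hy⟩, rfl, hx⟩
      exact ⟨hy, hx⟩
  rw [h]
  exact hT.isClosed.preimage (by fun_prop)

theorem eigenprojection_mem (hT : IsSelfAdjoint T) (c : ℝ) (x : H) :
    eigenprojection T c x ∈ eigenspace T c := by
  exact (isClosed_eigenspace hT c).submodule_topologicalClosure_eq.le
    (Submodule.starProjection_apply_mem (eigenspace T c).topologicalClosure x)

theorem eigenprojection_apply_of_mem {c : ℝ} {x : H} (hx : x ∈ eigenspace T c) :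
    eigenprojection T c x = x :=
  Submodule.starProjection_eq_self_iff.mpr ((eigenspace T c).le_topologicalClosure hx)

theorem eigenprojection_apply_of_ne (hT : IsSelfAdjoint T) {c d : ℝ} (hcd : c ≠ d) {x : H}
    (hx : x ∈ eigenspace T c) : eigenprojection T d x = 0 := by
  refine (Submodule.starProjection_apply_eq_zero_iff _).mpr ?_
  have h := (eigenspace_orthogonalFamily hT).isOrtho hcd.symm
  exact (Submodule.isOrtho_iff_le.mp h.symm) ((eigenspace T c).le_topologicalClosure hx)

theorem inner_eigenprojection (c : ℝ) (x y : H) :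
    inner ℂ x (eigenprojection T c y) = inner ℂ (eigenprojection T c x) y :=
  (Submodule.inner_starProjection_left_eq_right _ x y).symm

theorem inner_apply_eigenvector (hT : IsSelfAdjoint T) {c : ℝ} {e : H} (he : e ∈ eigenspace T c)
    (y : T.domain) : inner ℂ e (T y) = (c : ℂ) * inner ℂ e (y : H) := by
  obtain ⟨h, he⟩ := he
  have hs := LinearPMap.adjoint_isFormalAdjoint (T := T) hT.dense_domain
  rw [LinearPMap.isSelfAdjoint_def.mp hT] at hs
  rw [← hs ⟨e, h⟩ y, he, inner_smul_left, Complex.conj_ofReal]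

theorem hasSum_eigenvector (hT : IsSelfAdjoint T) (f : ℝ → ℝ) {c : ℝ} {e : H}
    (he : e ∈ eigenspace T c) :
    HasSum (fun d : ℝ => (f d : ℂ) • eigenprojection T d e) ((f c : ℂ) • e) := by
  have h := hasSum_single (f := fun d : ℝ => (f d : ℂ) • eigenprojection T d e) c fun d hd => by
    rw [eigenprojection_apply_of_ne hT hd.symm he, smul_zero]
  simpa only [eigenprojection_apply_of_mem he] using h

theorem mem_eigenspace_functionalCalculus (hT : IsSelfAdjoint T) (f : ℝ → ℝ) {c : ℝ} {e : H}
    (he : e ∈ eigenspace T c) : e ∈ eigenspace (functionalCalculus T f) (f c) :=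
  ⟨(hasSum_eigenvector hT f he).summable, (hasSum_eigenvector hT f he).tsum_eq⟩

theorem inner_tsum_eigenvector (hT : IsSelfAdjoint T) (f : ℝ → ℝ) {c : ℝ} {e x : H}
    (he : e ∈ eigenspace T c) (hx : Summable fun d : ℝ => (f d : ℂ) • eigenprojection T d x) :
    inner ℂ e (∑' d : ℝ, (f d : ℂ) • eigenprojection T d x) = (f c : ℂ) * inner ℂ e x := by
  have h1 := hx.hasSum.mapL (innerSL ℂ e)
  have h2 : HasSum (fun d : ℝ => innerSL ℂ e ((f d : ℂ) • eigenprojection T d x))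
      ((f c : ℂ) * inner ℂ e x) := by
    have h := hasSum_single (f := fun d : ℝ => innerSL ℂ e ((f d : ℂ) • eigenprojection T d x)) c
      fun d hd => by
        rw [innerSL_apply_apply, inner_smul_right, inner_eigenprojection,
          eigenprojection_apply_of_ne hT hd.symm he, inner_zero_left, mul_zero]
    rwa [innerSL_apply_apply, inner_smul_right, inner_eigenprojection,
      eigenprojection_apply_of_mem he] at h
  exact h1.unique h2

theorem inner_functionalCalculus (hT : IsSelfAdjoint T) (f : ℝ → ℝ) {c : ℝ} {e : H}
    (he : e ∈ eigenspace T c) (x : (functionalCalculus T f).domain) :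
    inner ℂ e (functionalCalculus T f x) = (f c : ℂ) * inner ℂ e (x : H) :=
  inner_tsum_eigenvector hT f he x.2

theorem summable_boundedFunctionalCalculus (hT : IsSelfAdjoint T) {f : ℝ → ℝ} {M : ℝ}
    (hM : ∀ c, |f c| ≤ M) (x : H) :
    Summable fun d : ℝ => (f d : ℂ) • eigenprojection T d x := by
  have h : x ∈ (functionalCalculus T f).domain := by
    rw [functionalCalculus_domain_eq_top hT hM]; trivial
  exact h

section Bounded

variable (hT : IsSelfAdjoint T) {f : ℝ → ℝ} {M : ℝ} (hM : ∀ c, |f c| ≤ M)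

theorem boundedFunctionalCalculus_eigenvector {c : ℝ} {e : H} (he : e ∈ eigenspace T c) :
    boundedFunctionalCalculus hT f hM e = (f c : ℂ) • e :=
  (hasSum_eigenvector hT f he).tsum_eq

theorem inner_boundedFunctionalCalculus {c : ℝ} {e : H} (he : e ∈ eigenspace T c) (x : H) :
    inner ℂ e (boundedFunctionalCalculus hT f hM x) = (f c : ℂ) * inner ℂ e x :=
  inner_tsum_eigenvector hT f he (summable_boundedFunctionalCalculus hT hM x)

theorem norm_boundedFunctionalCalculus_le : ‖boundedFunctionalCalculus hT f hM‖ ≤ M :=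
  LinearMap.mkContinuous_norm_le _ ((abs_nonneg _).trans (hM 0)) _

/-- If `f` is supported on eigenvalues whose eigenspaces lie in a closed subspace `W`, then `f(T)`
takes its values in `W`. -/
theorem boundedFunctionalCalculus_mem {W : Submodule ℂ H} (hW : IsClosed (W : Set H))
    (hf : ∀ c, f c ≠ 0 → eigenspace T c ≤ W) (x : H) :
    boundedFunctionalCalculus hT f hM x ∈ W := by
  rw [boundedFunctionalCalculus_apply]
  refine tsum_mem hW fun c => ?_
  by_cases h : f c = 0
  · simp [h]
  · exact W.smul_mem _ (hf c h (eigenprojection_mem hT c x))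

end Bounded

/-- Two bounded operators which agree on all eigenvectors agree. -/
theorem ext_eigenvector (htot : (⨆ c, eigenspace T c)ᗮ = ⊥) {A B : H →L[ℂ] H}
    (h : ∀ c, ∀ e ∈ eigenspace T c, A e = B e) : A = B := by
  have hker : IsClosed (((A - B : H →L[ℂ] H) : H →ₗ[ℂ] H).ker : Set H) := (A - B).isClosed_ker
  have h1 : (⨆ c, eigenspace T c) ≤ ((A - B : H →L[ℂ] H) : H →ₗ[ℂ] H).ker :=
    iSup_le fun c e he => by simp [h c e he]
  have h2 := Submodule.topologicalClosure_minimal _ h1 hker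
  rw [Submodule.topologicalClosure_eq_top_iff.mpr htot] at h2
  ext x
  have hx : (A - B) x = 0 := h2 (Submodule.mem_top (x := x))
  simpa [sub_eq_zero] using hx

/-- Two bounded operators with the same matrix entries between eigenvectors agree. -/
theorem ext_inner_eigenvector (htot : (⨆ c, eigenspace T c)ᗮ = ⊥) {A B : H →L[ℂ] H}
    (h : ∀ c d, ∀ e ∈ eigenspace T c, ∀ e' ∈ eigenspace T d,
      inner ℂ e (A e') = inner ℂ e (B e')) : A = B :=
  ext_eigenvector htot fun d e' he' => eq_of_inner_eigenvector htot fun c e he => h c d e he e' he'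

/-- The inverse of a self-adjoint operator off its kernel, extended by `0` to the kernel; its
existence as a compact operator makes the operator diagonalizable. -/
theorem exists_compact_inverse (hT : IsSelfAdjoint T) (hK : HasCompactInverseOffKernel T) :
    (⨆ c, eigenspace T c)ᗮ = ⊥ ∧ ∃ K : H →L[ℂ] H, IsCompactOperator K ∧
      ∀ c, ∀ e ∈ eigenspace T c, K e = ((c⁻¹ : ℝ) : ℂ) • e := by
  obtain ⟨K, hKc, hK⟩ := hK
  set N := eigenspace T 0 with hN
  have hNc : IsClosed (N : Set H) := isClosed_eigenspace hT 0
  have : CompleteSpace N := hNc.completeSpace_coe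
  set K' : H →L[ℂ] H := K * Nᗮ.starProjection with hK'
  have hmem : ∀ x, Nᗮ.starProjection x ∈ Nᗮ := fun x => Submodule.starProjection_apply_mem _ _
  have hK'mem : ∀ x, K' x ∈ Nᗮ := fun x => (hK _ (hmem x)).1
  have hK'dom : ∀ x, K' x ∈ T.domain := fun x => (hK _ (hmem x)).2.choose
  have hTK' : ∀ x, T ⟨K' x, hK'dom x⟩ = Nᗮ.starProjection x := fun x =>
    (hK _ (hmem x)).2.choose_spec
  have hK'c : IsCompactOperator K' := hKc.comp_clm Nᗮ.starProjection
  have hs := LinearPMap.adjoint_isFormalAdjoint (T := T) hT.dense_domain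
  rw [LinearPMap.isSelfAdjoint_def.mp hT] at hs
  -- `K` is not assumed symmetric; symmetry of `K'` comes from that of `T`, as `T K'` is the
  -- projection onto `(ker T)^⊥`.
  have hsymm : (K' : H →ₗ[ℂ] H).IsSymmetric := by
    intro x y
    have h1 : inner ℂ (K' x) y = inner ℂ (K' x) (Nᗮ.starProjection y) := by
      rw [← Submodule.inner_starProjection_left_eq_right,
        Submodule.starProjection_eq_self_iff.mpr (hK'mem x)]
    have h2 : inner ℂ x (K' y) = inner ℂ (Nᗮ.starProjection x) (K' y) := by
      rw [Submodule.inner_starProjection_left_eq_right,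
        Submodule.starProjection_eq_self_iff.mpr (hK'mem y)]
    have h3 := hs ⟨K' x, hK'dom x⟩ ⟨K' y, hK'dom y⟩
    rw [hTK', hTK'] at h3
    exact h1.trans (h3.symm.trans h2.symm)
  -- The spectral theorem for the compact symmetric `K'` gives a total set of eigenvectors: those
  -- for `0` lie in `ker T`, and those for `μ ≠ 0` are eigenvectors of `T` for `μ⁻¹`.
  have htot : (⨆ c, eigenspace T c)ᗮ = ⊥ := by
    rw [eq_bot_iff, ← ContinuousLinearMap.orthogonalComplement_iSup_eigenspaces_eq_bot hK'c hsymm]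
    refine Submodule.orthogonal_le (iSup_le fun μ x hx => ?_)
    have hx' : K' x = μ • x := Module.End.mem_eigenspace_iff.mp hx
    by_cases hμ : μ = 0
    · rw [hμ, zero_smul] at hx'
      have h0 : Nᗮ.starProjection x = 0 := by
        rw [← hTK' x]
        have : (⟨K' x, hK'dom x⟩ : T.domain) = 0 := Subtype.ext hx'
        rw [this, LinearPMap.map_zero]
      have hxN : x ∈ N := by
        rw [Submodule.starProjection_orthogonal_val, sub_eq_zero] at h0
        rw [h0]
        exact Submodule.starProjection_apply_mem _ _
      exact Submodule.mem_iSup_of_mem 0 hxN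
    · by_cases hx0 : x = 0
      · rw [hx0]; exact Submodule.zero_mem _
      have hreal : (μ.re : ℂ) = μ :=
        Complex.conj_eq_iff_re.mp (hsymm.conj_eigenvalue_eq_self
          (Module.End.hasEigenvalue_of_hasEigenvector ⟨hx, hx0⟩))
      have hxeq : x = μ⁻¹ • K' x := by rw [hx', smul_smul, inv_mul_cancel₀ hμ, one_smul]
      have hxN : x ∈ Nᗮ := by rw [hxeq]; exact Nᗮ.smul_mem _ (hK'mem x)
      have hdom : x ∈ T.domain := by rw [hxeq]; exact T.domain.smul_mem _ (hK'dom x)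
      refine Submodule.mem_iSup_of_mem (μ.re⁻¹) ⟨hdom, ?_⟩
      have h1 : (⟨x, hdom⟩ : T.domain) = μ⁻¹ • ⟨K' x, hK'dom x⟩ := Subtype.ext hxeq
      rw [h1, LinearPMap.map_smul, hTK', Submodule.starProjection_eq_self_iff.mpr hxN,
        Complex.ofReal_inv, hreal]
  refine ⟨htot, K', hK'c, fun c e he => ?_⟩
  refine eq_of_inner_eigenvector htot fun d e' he' => ?_
  have h1 := inner_apply_eigenvector hT he' ⟨K' e, hK'dom e⟩
  rw [hTK'] at h1
  -- With the convention `0⁻¹ = 0`, the formula `K' e = c⁻¹ e` includes the kernel.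
  by_cases hc : c = 0
  · subst hc
    have h0 : Nᗮ.starProjection e = 0 := by
      rw [Submodule.starProjection_orthogonal_val, sub_eq_zero]
      exact (Submodule.starProjection_eq_self_iff.mpr he).symm
    have h2 : K' e = 0 := by rw [hK', mul_apply_eq_comp, h0, map_zero]
    rw [h2]; simp
  · have heN : e ∈ Nᗮ := by
      have h := (eigenspace_orthogonalFamily hT).isOrtho hc
      have h' := (Submodule.isOrtho_iff_le.mp h) ((eigenspace T c).le_topologicalClosure he)
      exact Submodule.orthogonal_le (eigenspace T 0).le_topologicalClosure h'
    rw [Submodule.starProjection_eq_self_iff.mpr heN] at h1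
    have h4 : (c : ℂ) * inner ℂ e' e = d * inner ℂ e' e := by
      have := inner_apply_eigenvector hT he' ⟨e, he.choose⟩
      rw [he.choose_spec, inner_smul_right] at this
      exact this
    rw [inner_smul_right]
    by_cases hd : d = 0
    · subst hd
      have h5 : inner ℂ e' (K' e) = 0 := (Submodule.mem_orthogonal _ _).mp (hK'mem e) e' he'
      have h6 : inner ℂ e' e = 0 := (Submodule.mem_orthogonal _ _).mp heN e' he'
      rw [h5, h6, mul_zero]
    · have hc' : (c : ℂ) ≠ 0 := by exact_mod_cast hc
      have hd' : (d : ℂ) ≠ 0 := by exact_mod_cast hd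
      rw [Complex.ofReal_inv]
      apply mul_left_cancel₀ hd'
      simp only at h1
      rw [← h1, ← mul_assoc, mul_comm (d : ℂ), mul_assoc, ← h4, ← mul_assoc,
        inv_mul_cancel₀ hc', one_mul]

end FunctionalCalculus

/-! ### Counting the eigenvalues of `|T|` -/

section Eigenvalues

open Filter Topology

variable {H : Type*} [NormedAddCommGroup H] [InnerProductSpace ℂ H]

theorem positiveEigenvalue_le (T : H →ₗ.[ℂ] H) {n : ℕ} {r : ℝ} (hr : 0 < r)
    (h : (n : Cardinal) ≤
      Module.rank ℂ (⨆ c ∈ Set.Ioc (0 : ℝ) r, eigenspace T c : Submodule ℂ H)) :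
    positiveEigenvalue T n ≤ ENNReal.ofReal r :=
  iInf_le (fun s : {r : ℝ // 0 < r ∧ (n : Cardinal) ≤
    Module.rank ℂ (⨆ c ∈ Set.Ioc (0 : ℝ) r, eigenspace T c : Submodule ℂ H)} =>
      ENNReal.ofReal s.1) ⟨r, hr, h⟩

/-- If the union of a chain of subspaces has dimension at least `n`, so has one of them. -/
theorem exists_le_rank_of_le_rank_iSup {V ι : Type*} [AddCommGroup V] [Module ℂ V] [Nonempty ι]
    [LinearOrder ι] {W : ι → Submodule ℂ V} (hW : Monotone W) {n : ℕ}
    (h : (n : Cardinal) ≤ Module.rank ℂ (⨆ i, W i : Submodule ℂ V)) :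
    ∃ i, (n : Cardinal) ≤ Module.rank ℂ (W i) := by
  obtain ⟨v, hv⟩ := Module.le_rank_iff.mp h
  have hex : ∀ i, ∃ r, (v i : V) ∈ W r := fun i =>
    (Submodule.mem_iSup_of_directed W hW.directed_le).mp (v i).2
  choose r hr using hex
  obtain ⟨R, hR⟩ := Finite.exists_le r
  have hmem : ∀ i, (v i : V) ∈ W R := fun i => hW (hR i) (hr i)
  have hli : LinearIndependent ℂ fun i => (⟨(v i : V), hmem i⟩ : W R) := by
    refine LinearIndependent.of_comp (W R).subtype ?_
    exact hv.map' (Submodule.subtype _) (Submodule.ker_subtype _)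
  exact ⟨R, Module.le_rank_iff.mpr ⟨_, hli⟩⟩

/-- The eigenspaces for the positive eigenvalues below the `(k + 1)`-st one span a space of
dimension at most `k`. -/
theorem rank_iSup_eigenspace_lt_le (T : H →ₗ.[ℂ] H) (k : ℕ) :
    Module.rank ℂ (⨆ c ∈ {c : ℝ | 0 < c ∧ ENNReal.ofReal c < positiveEigenvalue T (k + 1)},
      eigenspace T c : Submodule ℂ H) ≤ k := by
  generalize hm : positiveEigenvalue T (k + 1) = m
  rcases {c : ℝ | 0 < c ∧ ENNReal.ofReal c < m}.eq_empty_or_nonempty with hempty | hne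
  · have hbot : (⨆ c ∈ {c : ℝ | 0 < c ∧ ENNReal.ofReal c < m}, eigenspace T c : Submodule ℂ H)
        ≤ ⊥ := iSup₂_le fun c hc => (hempty.le hc).elim
    exact (Submodule.rank_mono hbot).trans (by simp)
  · by_contra hcon
    have hk : ((k + 1 : ℕ) : Cardinal) ≤ Module.rank ℂ
        (⨆ c ∈ {c : ℝ | 0 < c ∧ ENNReal.ofReal c < m}, eigenspace T c : Submodule ℂ H) := by
      rw [Nat.cast_succ]
      exact Cardinal.natCast_add_one_le_iff.mpr (not_le.mp hcon)
    have hmono : Monotone fun r : {c : ℝ | 0 < c ∧ ENNReal.ofReal c < m} =>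
        (⨆ c ∈ Set.Ioc (0 : ℝ) r, eigenspace T c : Submodule ℂ H) := fun r s hrs =>
      biSup_mono fun c hc => ⟨hc.1, hc.2.trans hrs⟩
    have : Nonempty {c : ℝ | 0 < c ∧ ENNReal.ofReal c < m} := hne.to_subtype
    have hle : (⨆ c ∈ {c : ℝ | 0 < c ∧ ENNReal.ofReal c < m}, eigenspace T c : Submodule ℂ H)
        ≤ ⨆ r : {c : ℝ | 0 < c ∧ ENNReal.ofReal c < m},
          ⨆ c ∈ Set.Ioc (0 : ℝ) r, eigenspace T c :=
      iSup₂_le fun c hc => le_iSup_of_le ⟨c, hc⟩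
        (le_biSup (fun c => eigenspace T c) (Set.right_mem_Ioc.mpr hc.1))
    -- Any `k + 1` independent vectors would already lie in the span for a single interval `(0, R]`
    -- with `R` below the infimum, a contradiction.
    obtain ⟨R, hR⟩ := exists_le_rank_of_le_rank_iSup hmono (hk.trans (Submodule.rank_mono hle))
    have h := positiveEigenvalue_le T R.2.1 hR
    rw [hm] at h
    exact absurd h (not_le.mpr R.2.2)

/-- If the eigenvalues in `(0, r]` have finite total multiplicity less than `n`, then the `n`-th
positive eigenvalue is at least `r`. -/
theorem le_positiveEigenvalue (T : H →ₗ.[ℂ] H) {n d : ℕ} {r : ℝ} (hdn : d < n)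
    (h : Module.rank ℂ (⨆ c ∈ Set.Ioc (0 : ℝ) r, eigenspace T c : Submodule ℂ H) ≤ d) :
    ENNReal.ofReal r ≤ positiveEigenvalue T n := by
  refine le_iInf fun s => ENNReal.ofReal_le_ofReal ?_
  by_contra hlt
  have hmono : (⨆ c ∈ Set.Ioc (0 : ℝ) s, eigenspace T c : Submodule ℂ H)
      ≤ ⨆ c ∈ Set.Ioc (0 : ℝ) r, eigenspace T c :=
    biSup_mono fun c hc => ⟨hc.1, hc.2.trans (not_le.mp hlt).le⟩
  have h1 := s.2.2.trans ((Submodule.rank_mono hmono).trans h)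
  exact absurd hdn (not_lt.mpr (by exact_mod_cast h1))

variable [CompleteSpace H] {T : H →ₗ.[ℂ] H}

/-- On the span of the eigenspaces of `|T|` for eigenvalues in `(0, r]`, the inverse of `T` is
bounded below by `1 / r`. -/
theorem norm_le_mul_norm_inverse (hT : IsSelfAdjoint T) (htot : (⨆ c, eigenspace T c)ᗮ = ⊥)
    {K : H →L[ℂ] H} (hK : ∀ c, ∀ e ∈ eigenspace T c, K e = ((c⁻¹ : ℝ) : ℂ) • e) {r : ℝ}
    (hr : 0 < r) {x : H}
    (hx : x ∈ (⨆ c ∈ Set.Ioc (0 : ℝ) r, eigenspace (functionalCalculus T fun c => |c|) c :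
      Submodule ℂ H)) : ‖x‖ ≤ r * ‖K x‖ := by
  classical
  have hχ : ∀ c : ℝ, |if |c| ∈ Set.Ioc 0 r then (1 : ℝ) else 0| ≤ 1 := by
    intro c; split_ifs <;> simp
  have hh : ∀ c : ℝ, |if |c| ∈ Set.Ioc 0 r then c else 0| ≤ r := by
    intro c
    split_ifs with h
    · exact h.2
    · simpa using hr.le
  set A := boundedFunctionalCalculus hT _ hχ with hA
  set B := boundedFunctionalCalculus hT _ hh with hB
  -- `B` is `T` truncated to `0 < |c| ≤ r`, so `‖B‖ ≤ r`, and `B K` is the spectral projection `A`,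
  -- which fixes `x`.
  have hBK : B * K = A := by
    refine ext_eigenvector htot fun c e he => ?_
    rw [mul_apply_eq_comp, hK c e he, map_smul, boundedFunctionalCalculus_eigenvector hT hh he,
      boundedFunctionalCalculus_eigenvector hT hχ he, smul_smul]
    congr 1
    split_ifs with h
    · have hc : c ≠ 0 := abs_pos.mp h.1
      rw [← Complex.ofReal_mul, inv_mul_cancel₀ hc]
    · simp
  have hsub : (⨆ c ∈ Set.Ioc (0 : ℝ) r, eigenspace (functionalCalculus T fun c => |c|) c :
      Submodule ℂ H) ≤ ((A - 1 : H →L[ℂ] H) : H →ₗ[ℂ] H).ker := by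
    refine iSup₂_le fun c hc y hy => ?_
    have hAy : A y = y := by
      refine eq_of_inner_eigenvector htot fun d e he => ?_
      rw [inner_boundedFunctionalCalculus hT hχ he]
      obtain ⟨hdom, hy⟩ := hy
      have h1 := inner_functionalCalculus hT _ he ⟨y, hdom⟩
      rw [hy, inner_smul_right] at h1
      split_ifs with h
      · simp
      · have hne : (c : ℂ) - (|d| : ℝ) ≠ 0 := by
          rw [sub_ne_zero]
          intro h'
          have h2 : c = |d| := by exact_mod_cast h'
          exact h (h2 ▸ hc)
        have h3 : ((c : ℂ) - (|d| : ℝ)) * inner ℂ e y = 0 := by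
          rw [sub_mul, sub_eq_zero]; exact h1
        rw [(mul_eq_zero.mp h3).resolve_left hne, mul_zero]
    simp [hAy]
  have hAx : A x = x := by
    have h := hsub hx
    have h' : (A - 1) x = 0 := h
    simpa [sub_eq_zero] using h'
  calc ‖x‖ = ‖B (K x)‖ := by rw [← mul_apply_eq_comp, hBK, hAx]
    _ ≤ r * ‖K x‖ := (B.le_opNorm _).trans
      (by gcongr; exact norm_boundedFunctionalCalculus_le hT hh)

variable (hT : IsSelfAdjoint T) (hinv : HasCompactInverseOffKernel T)
include hT hinv

/-- The eigenvalues of `|T|` in `(0, r]` have finite total multiplicity. -/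
theorem exists_rank_iSup_eigenspace_abs_le {r : ℝ} (hr : 0 < r) :
    ∃ d : ℕ, Module.rank ℂ (⨆ c ∈ Set.Ioc (0 : ℝ) r,
      eigenspace (functionalCalculus T fun c => |c|) c : Submodule ℂ H) ≤ d := by
  obtain ⟨htot, K, hKc, hK⟩ := exists_compact_inverse hT hinv
  -- With error `1/(2r)`, `R x = 0` forces `‖x‖ ≤ r ‖K x‖ ≤ ‖x‖/2`; so `R` is injective on the span,
  -- whose dimension is therefore at most `d`.
  obtain ⟨R, ⟨d, hd⟩, -, hR⟩ := exists_finiteDimensional_norm_sub_le hKc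
    (ε := 1 / (2 * r)) (by positivity)
  refine ⟨d, le_trans ?_ hd⟩
  refine LinearMap.rank_le_of_injective
    ((R : H →ₗ[ℂ] H).rangeRestrict ∘ₗ Submodule.subtype _) ?_
  rw [← LinearMap.ker_eq_bot, LinearMap.ker_eq_bot']
  rintro ⟨x, hx⟩ h0
  have hRx : R x = 0 := by simpa using congrArg Subtype.val h0
  have h1 := norm_le_mul_norm_inverse hT htot hK hr hx
  have h2 : ‖K x‖ ≤ 1 / (2 * r) * ‖x‖ := by
    have : K x = (K - R) x := by simp [hRx]
    rw [this]
    exact ((K - R).le_opNorm x).trans (by gcongr)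
  have h3 : ‖x‖ ≤ 1 / 2 * ‖x‖ := by
    calc ‖x‖ ≤ r * (1 / (2 * r) * ‖x‖) := h1.trans (by gcongr)
      _ = 1 / 2 * ‖x‖ := by field_simp
  have h4 : ‖x‖ = 0 := le_antisymm (by linarith) (norm_nonneg x)
  exact Subtype.ext (norm_eq_zero.mp h4)

/-- Since `‖x‖ ≤ r ‖K‖ ‖x‖` on the span, no eigenvalue is as small as `1/(‖K‖+1)`. Without this, the
inverse could be `∞`, whose real value is `0`. -/
theorem positiveEigenvalue_abs_ne_zero (k : ℕ) :
    positiveEigenvalue (functionalCalculus T fun c => |c|) (k + 1) ≠ 0 := by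
  obtain ⟨htot, K, hKc, hK⟩ := exists_compact_inverse hT hinv
  have hr : 0 < 1 / (‖K‖ + 1) := by positivity
  have hbot : (⨆ c ∈ Set.Ioc (0 : ℝ) (1 / (‖K‖ + 1)),
      eigenspace (functionalCalculus T fun c => |c|) c : Submodule ℂ H) = ⊥ := by
    rw [eq_bot_iff]
    intro x hx
    have h1 := norm_le_mul_norm_inverse hT htot hK hr hx
    have h2 := h1.trans (mul_le_mul_of_nonneg_left (K.le_opNorm x) hr.le)
    rw [one_div, inv_mul_eq_div, le_div_iff₀ (by positivity)] at h2
    have h3 : ‖x‖ = 0 := le_antisymm (by linarith) (norm_nonneg x)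
    exact norm_eq_zero.mp h3
  have h := le_positiveEigenvalue (functionalCalculus T fun c => |c|) (n := k + 1) (d := 0)
    (r := 1 / (‖K‖ + 1)) (Nat.succ_pos k) (by rw [hbot]; simp)
  exact ((ENNReal.ofReal_pos.mpr hr).trans_le h).ne'

theorem tendsto_inv_positiveEigenvalue_abs :
    Tendsto (fun k : ℕ =>
      ((positiveEigenvalue (functionalCalculus T fun c => |c|) (k + 1))⁻¹).toReal) atTop (𝓝 0) := by
  rw [Metric.tendsto_atTop]
  intro ε hε
  obtain ⟨d, hd⟩ := exists_rank_iSup_eigenspace_abs_le hT hinv (r := 2 / ε) (by positivity)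
  refine ⟨d, fun n hn => ?_⟩
  rw [Real.dist_eq, sub_zero, abs_of_nonneg ENNReal.toReal_nonneg]
  have h := le_positiveEigenvalue _ (n := n + 1) (Nat.lt_succ_of_le hn) hd
  have h1 : (positiveEigenvalue (functionalCalculus T fun c => |c|) (n + 1))⁻¹
      ≤ ENNReal.ofReal (ε / 2) := by
    have := ENNReal.inv_le_inv.mpr h
    rwa [← ENNReal.ofReal_inv_of_pos (by positivity), inv_div] at this
  exact (ENNReal.toReal_le_of_le_ofReal (by positivity) h1).trans_lt (by linarith)

end Eigenvalues

/-! ### Matrix entries of commutators -/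

section Commutators

variable {H : Type*} [NormedAddCommGroup H] [InnerProductSpace ℂ H]
  {T : H →ₗ.[ℂ] H}

/-- The hypotheses say that `S` acts as `f(T)` on eigenvectors, from either side of the inner
product. This covers both `D` and `|D|`, and afterwards no domains intervene. -/
theorem inner_commutator_eigenvector {f : ℝ → ℝ} {S : H →ₗ.[ℂ] H}
    (hS : ∀ c, ∀ e ∈ eigenspace T c, e ∈ eigenspace S (f c))
    (hS' : ∀ c, ∀ e ∈ eigenspace T c, ∀ x : S.domain,
      inner ℂ e (S x) = (f c : ℂ) * inner ℂ e (x : H))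
    {a B : H →L[ℂ] H} (hB : IsBoundedCommutator S a B) {c d : ℝ} {e e' : H}
    (he : e ∈ eigenspace T c) (he' : e' ∈ eigenspace T d) :
    inner ℂ e (B e') = ((f c : ℂ) - f d) * inner ℂ e (a e') := by
  obtain ⟨hdom, hSe⟩ := hS d e' he'
  obtain ⟨hadom, h⟩ := hB ⟨e', hdom⟩
  rw [hSe] at h
  simp only at h
  rw [← h, inner_sub_right, hS' c e he, map_smul, inner_smul_right, sub_mul]

end Commutators

/-! ### Scalar functions behind the commutator estimate -/

section Multipliers

/-- The function `c ↦ 1_{c = 0} + c / √(1 + c²)` of which `F` is the value at `D`. -/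
noncomputable def phaseFunction (c : ℝ) : ℝ := (if c = 0 then 1 else 0) + c / Real.sqrt (1 + c ^ 2)

theorem abs_phaseFunction_le (c : ℝ) : |phaseFunction c| ≤ 2 := by
  refine (abs_add_le _ _).trans ?_
  have h1 : |if c = 0 then (1 : ℝ) else 0| ≤ 1 := by split_ifs <;> simp
  linarith [abs_div_sqrt_one_add_sq_le c]

/-- The sign of a real number, with the sign of `0` taken to be `1`. -/
noncomputable def phaseSign (c : ℝ) : ℝ := if c < 0 then -1 else 1

theorem abs_phaseSign (c : ℝ) : |phaseSign c| = 1 := by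
  unfold phaseSign; split_ifs <;> simp

theorem abs_phaseFunction_sub_phaseSign_le {c : ℝ} (hc : c ≠ 0) :
    |phaseFunction c - phaseSign c| ≤ |c|⁻¹ ^ 2 := by
  have hs : 0 < Real.sqrt (1 + c ^ 2) := Real.sqrt_pos.mpr (by positivity)
  have hsq : Real.sqrt (1 + c ^ 2) ^ 2 = 1 + c ^ 2 := Real.sq_sqrt (by positivity)
  have hcpos : 0 < |c| := abs_pos.mpr hc
  set s := Real.sqrt (1 + c ^ 2) with hsdef
  have hcs : |c| ≤ s := Real.abs_le_sqrt (by linarith)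
  have h1 : |phaseFunction c - phaseSign c| = 1 - |c| / s := by
    have hle : |c| / s ≤ 1 := (div_le_one hs).mpr hcs
    unfold phaseFunction phaseSign
    rw [if_neg hc, zero_add, ← hsdef]
    rcases lt_or_gt_of_ne hc with h | h
    · rw [if_pos h, abs_of_neg h] at *
      rw [neg_div] at *
      rw [abs_of_nonneg (by linarith)]
      ring
    · rw [if_neg h.le.not_gt, abs_of_pos h] at *
      rw [abs_of_nonpos (by linarith)]
      ring
  rw [h1, inv_pow, ← one_div, le_div_iff₀ (by positivity), one_sub_div hs.ne', div_mul_eq_mul_div,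
    div_le_iff₀ hs, one_mul]
  -- Hence `1 - |c|/s = 1/(s(s+|c|))`, which is at most `1/c²` because `s ≥ |c|`.
  have h2 : (s - |c|) * (s + |c|) = 1 := by
    have := sq_abs c
    nlinarith
  have h3 : 0 ≤ s - |c| := by linarith
  have h4 : |c| * |c| ≤ (s + |c|) * s := by nlinarith
  calc (s - |c|) * |c| ^ 2 ≤ (s - |c|) * ((s + |c|) * s) := by
        rw [sq]; gcongr
    _ = s := by rw [← mul_assoc, h2, one_mul]

variable (m : ℝ≥0∞)

/-- The indicator function of `{0} ∪ {|c| ≥ m}`. -/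
noncomputable def cutoff (c : ℝ) : ℝ :=
  haveI := Classical.dec (c ≠ 0 ∧ ENNReal.ofReal |c| < m)
  if c ≠ 0 ∧ ENNReal.ofReal |c| < m then 0 else 1

theorem cutoff_zero : cutoff m 0 = 1 := by simp [cutoff]

theorem abs_cutoff_le (c : ℝ) : |cutoff m c| ≤ 1 := by
  unfold cutoff; split_ifs <;> simp

theorem cutoff_eq_zero_or (c : ℝ) : cutoff m c = 0 ∨
    cutoff m c = 1 ∧ (c = 0 ∨ m ≤ ENNReal.ofReal |c|) := by
  unfold cutoff
  split_ifs with h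
  · exact Or.inl rfl
  · refine Or.inr ⟨rfl, ?_⟩
    by_contra! hcon
    exact h hcon

variable {m}

theorem abs_cutoff_mul_inv_le (hm : m ≠ 0) (c : ℝ) : |cutoff m c * |c|⁻¹| ≤ m⁻¹.toReal := by
  rcases cutoff_eq_zero_or m c with h | ⟨h, h0 | h1⟩
  · rw [h]; simp
  · rw [h0]; simp
  · have hc : 0 < |c| := ENNReal.ofReal_pos.mp ((pos_iff_ne_zero.mpr hm).trans_le h1)
    rw [h, one_mul, abs_of_pos (inv_pos.mpr hc)]
    have h2 := ENNReal.inv_le_inv.mpr h1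
    rw [← ENNReal.ofReal_inv_of_pos hc] at h2
    exact (ENNReal.ofReal_le_iff_le_toReal (ENNReal.inv_ne_top.mpr hm)).mp h2

/-- At `c = 0` the difference vanishes exactly: the summand `P₀` of `F` gives the kernel the phase
`1`, the chosen sign of `0`. If `m = ∞`, only the kernel survives the cutoff and the bound is `0`.
-/
theorem abs_cutoff_mul_sub_le (hm : m ≠ 0) (c : ℝ) :
    |cutoff m c * (phaseFunction c - phaseSign c)| ≤ m⁻¹.toReal ^ 2 := by
  by_cases hc : c = 0
  · subst hc
    simp only [phaseFunction, phaseSign, if_pos, lt_irrefl, if_neg, zero_div, add_zero, sub_self,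
      mul_zero, abs_zero, not_false_eq_true]
    positivity
  · have h := abs_cutoff_mul_inv_le hm c
    have h' : |cutoff m c * |c|⁻¹| ^ 2 ≤ m⁻¹.toReal ^ 2 := by gcongr
    refine le_trans ?_ h'
    rw [abs_mul, abs_mul, mul_pow, abs_inv, abs_abs]
    have hq : |cutoff m c| = |cutoff m c| ^ 2 := by
      rcases cutoff_eq_zero_or m c with h | ⟨h, -⟩ <;> simp [h]
    rw [← hq]
    gcongr
    exact abs_phaseFunction_sub_phaseSign_le hc

/-- The scalar identity behind the decomposition of the commutator with the phase. -/
theorem cutoff_mul_phase_sub (c d : ℝ) :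
    cutoff m c * cutoff m d * (phaseFunction c - phaseFunction d) =
      (if c = 0 then 0 else cutoff m c) * (c - d) * (cutoff m d * |d|⁻¹)
      - (if c = 0 then 0 else cutoff m c * phaseSign c) * (|c| - |d|) * (cutoff m d * |d|⁻¹)
      - 2 * ((if c = 0 then 1 else 0) * (c - d) * (if d < 0 then cutoff m d * d⁻¹ else 0))
      - 2 * ((if c < 0 then cutoff m c * c⁻¹ else 0) * (c - d) * (if d = 0 then 1 else 0))
      + cutoff m c * (phaseFunction c - phaseSign c) * cutoff m d
      - cutoff m c * (cutoff m d * (phaseFunction d - phaseSign d)) := by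
  -- For `c, d ≠ 0`, `sgn c - sgn d = ((c - d) - sgn c (|c| - |d|)) / |d|`. If just one of them
  -- vanishes, the difference is `0` or `±2` and is nonzero only when the other is negative; the two
  -- terms with factor `2` account for this. At `d = 0` the first two terms drop out since `0⁻¹ =
  -- 0`.
  have key : cutoff m c * cutoff m d * (phaseSign c - phaseSign d) =
      (if c = 0 then 0 else cutoff m c) * (c - d) * (cutoff m d * |d|⁻¹)
      - (if c = 0 then 0 else cutoff m c * phaseSign c) * (|c| - |d|) * (cutoff m d * |d|⁻¹)
      - 2 * ((if c = 0 then 1 else 0) * (c - d) * (if d < 0 then cutoff m d * d⁻¹ else 0))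
      - 2 * ((if c < 0 then cutoff m c * c⁻¹ else 0) * (c - d) * (if d = 0 then 1 else 0)) := by
    unfold phaseSign
    rcases lt_trichotomy c 0 with hc | rfl | hc <;> rcases lt_trichotomy d 0 with hd | rfl | hd
    · simp only [hc, hd, hc.ne, hd.ne, if_true, if_false, abs_of_neg]
      field_simp [hc.ne, hd.ne]
      ring
    · simp only [hc, hc.ne, if_true, if_false, abs_of_neg, cutoff_zero, abs_zero, lt_irrefl]
      field_simp [hc.ne]
      ring
    · simp only [hc, hd, hc.ne, hd.ne', hd.not_gt, if_true, if_false, abs_of_neg, abs_of_pos]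
      field_simp [hc.ne, hd.ne']
      ring
    · simp only [hd, hd.ne, if_true, if_false, abs_of_neg, cutoff_zero, abs_zero, lt_irrefl]
      field_simp [hd.ne]
      ring
    · simp
    · simp only [hd, hd.ne', hd.not_gt, if_true, if_false, abs_of_pos, cutoff_zero, abs_zero,
        lt_irrefl]
      ring
    · simp only [hc, hd, hc.ne', hd.ne, hc.not_gt, if_true, if_false, abs_of_neg, abs_of_pos]
      field_simp [hc.ne', hd.ne]
      ring
    · simp only [hc, hc.ne', hc.not_gt, if_true, if_false, abs_of_pos, cutoff_zero, abs_zero,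
        lt_irrefl]
      ring
    · simp only [hc, hd, hc.ne', hd.ne', hc.not_gt, hd.not_gt, if_false, abs_of_pos]
      field_simp [hc.ne', hd.ne']
      ring
  linear_combination key

end Multipliers

end SpectralTriple

/-! ### The quantum differential -/

namespace EssentiallyDiscreteSpectralTriple

open SpectralTriple Filter Topology

variable {H : Type*} [NormedAddCommGroup H] [InnerProductSpace ℂ H] [CompleteSpace H]
  (X : EssentiallyDiscreteSpectralTriple H)

theorem iSup_eigenspace_orthogonal : (⨆ c, eigenspace X.D c)ᗮ = ⊥ :=
  (exists_compact_inverse X.isSelfAdjoint_D X.hasCompactInverse).1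

theorem F_eq : X.F =
    boundedFunctionalCalculus X.isSelfAdjoint_D phaseFunction abs_phaseFunction_le := by
  refine ext_eigenvector X.iSup_eigenspace_orthogonal fun c e he => ?_
  rw [boundedFunctionalCalculus_eigenvector _ _ he, F, add_apply,
    boundedFunctionalCalculus_eigenvector _ _ he, phaseFunction, Complex.ofReal_add, add_smul]
  congr 1
  by_cases hc : c = 0
  · subst hc
    simp [eigenprojection_apply_of_mem he]
  · simp [eigenprojection_apply_of_ne X.isSelfAdjoint_D hc he, hc]

theorem inner_quantumDifferential (a : H →L[ℂ] H) {c d : ℝ} {e e' : H}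
    (he : e ∈ eigenspace X.D c) (he' : e' ∈ eigenspace X.D d) :
    inner ℂ e (X.quantumDifferential a e') =
      Complex.I * (((phaseFunction c : ℂ) - phaseFunction d) * inner ℂ e (a e')) := by
  rw [quantumDifferential, smul_apply, sub_apply, mul_apply_eq_comp, mul_apply_eq_comp, F_eq,
    inner_smul_right, inner_sub_right, inner_boundedFunctionalCalculus _ _ he,
    boundedFunctionalCalculus_eigenvector _ _ he', map_smul, inner_smul_right, sub_mul]

variable {X} {a B B' : H →L[ℂ] H}

theorem inner_commutator_D (hB : IsBoundedCommutator X.D a B) {c d : ℝ} {e e' : H}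
    (he : e ∈ eigenspace X.D c) (he' : e' ∈ eigenspace X.D d) :
    inner ℂ e (B e') = ((c : ℂ) - d) * inner ℂ e (a e') :=
  inner_commutator_eigenvector (f := fun c => c) (fun _ _ h => h)
    (fun _ _ h x => inner_apply_eigenvector X.isSelfAdjoint_D h x) hB he he'

theorem inner_commutator_absD (hB : IsBoundedCommutator X.absD a B) {c d : ℝ} {e e' : H}
    (he : e ∈ eigenspace X.D c) (he' : e' ∈ eigenspace X.D d) :
    inner ℂ e (B e') = ((|c| : ℝ) - (|d| : ℝ) : ℂ) * inner ℂ e (a e') :=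
  inner_commutator_eigenvector (f := fun c => |c|)
    (fun _ _ h => mem_eigenspace_functionalCalculus X.isSelfAdjoint_D _ h)
    (fun _ _ h x => inner_functionalCalculus X.isSelfAdjoint_D _ h x) hB he he'

/-- If `a` commutes with `D`, then its quantum differential vanishes. -/
theorem quantumDifferential_eq_zero (hB : IsBoundedCommutator X.D a 0) :
    X.quantumDifferential a = 0 := by
  refine ext_inner_eigenvector X.iSup_eigenspace_orthogonal fun c d e he e' he' => ?_
  rw [inner_quantumDifferential X a he he', zero_apply, inner_zero_right]
  have h := inner_commutator_D hB he he'
  rw [zero_apply, inner_zero_right] at h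
  rcases mul_eq_zero.mp h.symm with h | h
  · have : c = d := by exact_mod_cast sub_eq_zero.mp h
    rw [this, sub_self, zero_mul, mul_zero]
  · rw [h, mul_zero, mul_zero]

theorem norm_cutoff_mul_quantumDifferential_le (hB : IsBoundedCommutator X.D a B)
    (hB' : IsBoundedCommutator X.absD a B') {m : ℝ≥0∞} (hm : m ≠ 0) :
    ‖boundedFunctionalCalculus X.isSelfAdjoint_D (cutoff m) (abs_cutoff_le m)
        * X.quantumDifferential a
        * boundedFunctionalCalculus X.isSelfAdjoint_D (cutoff m) (abs_cutoff_le m)‖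
      ≤ (5 * ‖B‖ + ‖B'‖) * m⁻¹.toReal + 2 * ‖a‖ * m⁻¹.toReal ^ 2 := by
  have hT := X.isSelfAdjoint_D
  set t := m⁻¹.toReal with ht
  have ht0 : 0 ≤ t := ENNReal.toReal_nonneg
  have hq := abs_cutoff_le m
  have hr := abs_cutoff_mul_inv_le hm
  have hg := abs_cutoff_mul_sub_le hm
  have hu : ∀ c : ℝ, |if c = 0 then 0 else cutoff m c| ≤ 1 := by
    intro c; split_ifs
    · simp
    · exact hq c
  have hw : ∀ c : ℝ, |if c = 0 then 0 else cutoff m c * phaseSign c| ≤ 1 := by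
    intro c; split_ifs
    · simp
    · rw [abs_mul, abs_phaseSign, mul_one]; exact hq c
  have hz : ∀ c : ℝ, |if c = 0 then (1 : ℝ) else 0| ≤ 1 := by
    intro c; split_ifs <;> simp
  have hn : ∀ c : ℝ, |if c < 0 then cutoff m c * c⁻¹ else 0| ≤ t := by
    intro c; split_ifs
    · have := hr c
      rwa [abs_mul, abs_inv, abs_abs, ← abs_inv, ← abs_mul] at this
    · simpa using ht0
  set Q := boundedFunctionalCalculus hT (cutoff m) hq with hQ
  set R := boundedFunctionalCalculus hT _ hr with hR
  set G := boundedFunctionalCalculus hT _ hg with hG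
  set U := boundedFunctionalCalculus hT _ hu with hU
  set W := boundedFunctionalCalculus hT _ hw with hW
  set Z := boundedFunctionalCalculus hT _ hz with hZ
  set N := boundedFunctionalCalculus hT _ hn with hN
  -- The operator form of `cutoff_mul_phase_sub`. The terms in `B` contribute `1 + 2 + 2 = 5`, the
  -- term in `B'` contributes `1`, and the two terms in `a` carry the factor `t²`.
  have key : Q * X.quantumDifferential a * Q = Complex.I •
      (U * B * R - W * B' * R - (2 : ℂ) • (Z * B * N) - (2 : ℂ) • (N * B * Z)
        + G * a * Q - Q * a * G) := by
    refine ext_inner_eigenvector X.iSup_eigenspace_orthogonal fun c d e he e' he' => ?_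
    have hs := congrArg (fun x : ℝ => (x : ℂ)) (cutoff_mul_phase_sub (m := m) c d)
    push_cast at hs
    simp only [smul_apply, sub_apply, add_apply, mul_apply_eq_comp, inner_smul_right,
      inner_sub_right, inner_add_right, hQ, hR, hG, hU, hW, hZ, hN,
      inner_boundedFunctionalCalculus hT _ he, boundedFunctionalCalculus_eigenvector hT _ he',
      map_smul, inner_quantumDifferential X a he he', inner_commutator_D hB he he',
      inner_commutator_absD hB' he he']
    push_cast
    linear_combination (Complex.I * inner ℂ e (a e')) * hs
  have h3 : ∀ (A₁ A₂ A₃ : H →L[ℂ] H) {x y : ℝ}, ‖A₁‖ ≤ x → ‖A₃‖ ≤ y →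
      ‖A₁ * A₂ * A₃‖ ≤ x * ‖A₂‖ * y := by
    intro A₁ A₂ A₃ x y h1 h2
    have hx : 0 ≤ x := (norm_nonneg _).trans h1
    calc ‖A₁ * A₂ * A₃‖ ≤ ‖A₁‖ * ‖A₂‖ * ‖A₃‖ :=
          (norm_mul_le _ _).trans (by gcongr; exact norm_mul_le _ _)
      _ ≤ x * ‖A₂‖ * y := by gcongr
  have nQ : ‖Q‖ ≤ 1 := norm_boundedFunctionalCalculus_le hT hq
  have nR : ‖R‖ ≤ t := norm_boundedFunctionalCalculus_le hT hr
  have nG : ‖G‖ ≤ t ^ 2 := norm_boundedFunctionalCalculus_le hT hg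
  have nU : ‖U‖ ≤ 1 := norm_boundedFunctionalCalculus_le hT hu
  have nW : ‖W‖ ≤ 1 := norm_boundedFunctionalCalculus_le hT hw
  have nZ : ‖Z‖ ≤ 1 := norm_boundedFunctionalCalculus_le hT hz
  have nN : ‖N‖ ≤ t := norm_boundedFunctionalCalculus_le hT hn
  have e1 := h3 U B R nU nR
  have e2 := h3 W B' R nW nR
  have e3 := h3 Z B N nZ nN
  have e4 := h3 N B Z nN nZ
  have e5 := h3 G a Q nG nQ
  have e6 := h3 Q a G nQ nG
  have h2 : ∀ A : H →L[ℂ] H, ‖(2 : ℂ) • A‖ = 2 * ‖A‖ := fun A => by simp [norm_smul]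
  rw [key, norm_smul, Complex.norm_I, one_mul]
  have htri : ‖U * B * R - W * B' * R - (2 : ℂ) • (Z * B * N) - (2 : ℂ) • (N * B * Z)
        + G * a * Q - Q * a * G‖ ≤ ‖U * B * R‖ + ‖W * B' * R‖ + 2 * ‖Z * B * N‖
        + 2 * ‖N * B * Z‖ + ‖G * a * Q‖ + ‖Q * a * G‖ := by
    rw [← h2, ← h2]
    refine (norm_sub_le _ _).trans (add_le_add_left ?_ _)
    refine (norm_add_le _ _).trans (add_le_add_left ?_ _)
    refine (norm_sub_le _ _).trans (add_le_add_left ?_ _)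
    refine (norm_sub_le _ _).trans (add_le_add_left ?_ _)
    exact norm_sub_le _ _
  linarith

/-- The singular values of the quantum differential are controlled by the cut-off of the quantum
differential to the kernel and the large eigenvalues of `D`. -/
theorem singularValue_quantumDifferential_le_norm (k : ℕ) (Y : H →L[ℂ] H) :
    singularValue (2 * k) Y ≤
      ‖boundedFunctionalCalculus X.isSelfAdjoint_D (cutoff (positiveEigenvalue X.absD (k + 1)))
          (abs_cutoff_le _) * Y
        * boundedFunctionalCalculus X.isSelfAdjoint_D
          (cutoff (positiveEigenvalue X.absD (k + 1))) (abs_cutoff_le _)‖ := by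
  have hT := X.isSelfAdjoint_D
  have hrank := rank_iSup_eigenspace_lt_le X.absD k
  generalize positiveEigenvalue X.absD (k + 1) = m at hrank ⊢
  set V : Submodule ℂ H := ⨆ c ∈ {c : ℝ | 0 < c ∧ ENNReal.ofReal c < m}, eigenspace X.absD c
    with hV
  have : FiniteDimensional ℂ V :=
    Module.rank_lt_aleph0_iff.mp (hrank.trans_lt Cardinal.natCast_lt_aleph0)
  have hVc : IsClosed (V : Set H) := V.closed_of_finiteDimensional
  have hc : ∀ c : ℝ, |1 - cutoff m c| ≤ 1 := by
    intro c
    rcases cutoff_eq_zero_or m c with h | ⟨h, -⟩ <;> simp [h]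
  set Q := boundedFunctionalCalculus hT (cutoff m) (abs_cutoff_le m) with hQ
  set C := boundedFunctionalCalculus hT _ hc with hC
  have hmem : ∀ x, C x ∈ V := by
    refine boundedFunctionalCalculus_mem hT hc hVc fun c hc0 e he => ?_
    have hsmall : c ≠ 0 ∧ ENNReal.ofReal |c| < m := by
      by_contra hcon
      exact hc0 (by simp only [cutoff, if_neg hcon, sub_self])
    have hmem : |c| ∈ {c : ℝ | 0 < c ∧ ENNReal.ofReal c < m} := ⟨abs_pos.mpr hsmall.1, hsmall.2⟩
    exact (le_biSup (fun c => eigenspace X.absD c) hmem)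
      (mem_eigenspace_functionalCalculus hT (fun c => |c|) he)
  have hCrank : (C : H →ₗ[ℂ] H).rank ≤ k := by
    refine (Submodule.rank_mono ?_).trans hrank
    rintro _ ⟨x, rfl⟩
    exact hmem x
  have hCQ : C + Q = 1 := by
    refine ext_eigenvector X.iSup_eigenspace_orthogonal fun c e he => ?_
    rw [add_apply, hC, hQ, boundedFunctionalCalculus_eigenvector hT _ he,
      boundedFunctionalCalculus_eigenvector hT _ he, ← add_smul]
    simp
  -- As `C + Q = 1`, this is exactly `Y - Q Y Q`; each summand has a factor `C` of rank at most `k`,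
  -- whence the index `2k`.
  have hR : ((C * Y + Q * Y * C : H →L[ℂ] H) : H →ₗ[ℂ] H).rank ≤ (2 * k : ℕ) := by
    refine (rank_clm_add_le _ _).trans ?_
    rw [two_mul, Nat.cast_add]
    exact add_le_add ((rank_mul_le_left _ _).trans hCrank) ((rank_mul_le_right _ _).trans hCrank)
  refine (singularValue_le_norm_sub Y _ hR).trans_eq ?_
  congr 1
  have e : Y = C * Y + Q * Y * C + Q * Y * Q := by
    rw [add_assoc, ← mul_add, hCQ, mul_one, ← add_mul, hCQ, one_mul]
  rw [sub_eq_iff_eq_add']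
  exact e

theorem exists_singularValue_quantumDifferential_le (hB : IsBoundedCommutator X.D a B)
    (hB' : IsBoundedCommutator X.absD a B') :
    ∃ ε : ℕ → ℝ, Tendsto ε atTop (𝓝 0) ∧ ∀ k : ℕ,
      singularValue (2 * k) (X.quantumDifferential a) ≤
        (5 * ‖B‖ + ‖B'‖) * (1 + ε k) * ((positiveEigenvalue X.absD (k + 1))⁻¹).toReal := by
  -- The choice of `ε` below divides by `5 ‖B‖ + ‖B'‖`. If `B = 0`, entries of `a` between distinct
  -- eigenvalues vanish, and so does `[F, a]`.
  rcases (norm_nonneg B).eq_or_lt with h0 | hpos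
  · have hB0 : B = 0 := norm_eq_zero.mp h0.symm
    subst hB0
    refine ⟨0, tendsto_const_nhds, fun k => ?_⟩
    rw [quantumDifferential_eq_zero hB]
    have h : singularValue (2 * k) (0 : H →L[ℂ] H) ≤ 0 :=
      (singularValue_le_norm_sub 0 0 (by simp)).trans_eq (by simp)
    refine h.trans ?_
    simp only [Pi.zero_apply]
    positivity
  · have hC : 0 < 5 * ‖B‖ + ‖B'‖ := by positivity
    have hlim := tendsto_inv_positiveEigenvalue_abs X.isSelfAdjoint_D X.hasCompactInverse
    -- The remainder `2 ‖a‖ λ_{k+1}⁻²` divided by the main term `(5 ‖B‖ + ‖B'‖) λ_{k+1}⁻¹`.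
    refine ⟨fun k => 2 * ‖a‖ / (5 * ‖B‖ + ‖B'‖)
      * ((positiveEigenvalue X.absD (k + 1))⁻¹).toReal, ?_, fun k => ?_⟩
    · have h := hlim.const_mul (2 * ‖a‖ / (5 * ‖B‖ + ‖B'‖))
      rwa [mul_zero] at h
    · have hm : positiveEigenvalue X.absD (k + 1) ≠ 0 :=
        positiveEigenvalue_abs_ne_zero X.isSelfAdjoint_D X.hasCompactInverse k
      refine (singularValue_quantumDifferential_le_norm (X := X) k _).trans
        ((norm_cutoff_mul_quantumDifferential_le hB hB' hm).trans_eq ?_)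
      field_simp

end EssentiallyDiscreteSpectralTriple

theorem mainTheorem3 {H : Type*} [NormedAddCommGroup H] [InnerProductSpace ℂ H]
    [CompleteSpace H] :
    (∀ T σ : H →L[ℂ] H, IsCompactOperator T → IsCompactOperator σ →
      ∃ (d : ℕ) (ε ε' : ℕ → ℝ),
        Filter.Tendsto ε Filter.atTop (nhds 0) ∧ Filter.Tendsto ε' Filter.atTop (nhds 0) ∧
        ∀ k : ℕ,
          (1 - ε' k) * SpectralTriple.singularValue (k + d) T
              ≤ SpectralTriple.singularValue k (T * (1 + σ)) ∧
          SpectralTriple.singularValue k (T * (1 + σ))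
              ≤ (1 + ε k) * SpectralTriple.singularValue k T) ∧
    (∀ (X : EssentiallyDiscreteSpectralTriple H) (a : H →L[ℂ] H) (ha : a ∈ X.A)
      (hb : SpectralTriple.HasBoundedCommutator X.absD a),
      ∃ ε : ℕ → ℝ, Filter.Tendsto ε Filter.atTop (nhds 0) ∧
        ∀ k : ℕ,
          SpectralTriple.singularValue (2 * k) (X.quantumDifferential a)
            ≤ (5 * ‖SpectralTriple.commutator (X.hasBoundedCommutator a ha)‖
                + ‖SpectralTriple.commutator hb‖) * (1 + ε k)
              * ((SpectralTriple.positiveEigenvalue X.absD (k + 1))⁻¹).toReal) := by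
  refine ⟨fun T σ hT hσ => ?_, fun X a ha hb => ?_⟩
  · obtain ⟨ε, hε, hle⟩ := SpectralTriple.exists_singularValue_mul_one_add_le hT hσ
    obtain ⟨d, ε', hε', hge⟩ := SpectralTriple.exists_le_singularValue_mul_one_add hT hσ
    exact ⟨d, ε, ε', hε, hε', fun k => ⟨hge k, hle k⟩⟩
  · exact EssentiallyDiscreteSpectralTriple.exists_singularValue_quantumDifferential_le
      (X.hasBoundedCommutator a ha).choose_spec hb.choose_spec
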